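/- Let $F$ be a totally real number field with ring of integers $\mathfrak{o}_F$, let $\varepsilon > 0$, and let $c, B > 0$. There is a constant $C > 0$, depending only on $F$, $\varepsilon$, $c$ and $B$, such that the following holds. Let $A$ be a division quaternion algebra over $F$ (a central division algebra of dimension $4$) for which there is an embedding $\sigma_0 : F \to \mathbb{R}$ with an isomorphism $A \otimes_{\sigma_0} \mathbb{R} \cong M_2(\mathbb{R})$, while $A \otimes_{\sigma} \mathbb{R}$ is isomorphic to Hamilton's quaternions for every other embedding $\sigma \neq \sigma_0$; let $\varphi_0 : A \to M_2(\mathbb{R})$ be the map induced by the first isomorphism. Let $\mathcal{O} \subset A$ be an $\mathfrak{o}_F$-order, and let $D$ be the absolute norm of its discriminant, the ideal of $\mathfrak{o}_F$ generated by all $\det(\operatorname{tr}(x_i x_j))_{1 \le i,j \le 4}$ with $x_1, \dots, x_4 \in \mathcal{O}$, where $\operatorname{tr}$ is the reduced trace. Write $\operatorname{nr}$ for the reduced norm and $d$ for the hyperbolic distance on the upper half-plane $\mathfrak{h}^2$, on which $\operatorname{GL}_2(\mathbb{R})$ acts by isometries through $\operatorname{PGL}_2(\mathbb{R})$. For an integer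 $m \geq 1$, a point $z \in \mathfrak{h}^2$ and $\delta > 0$ put $$\mathcal{O}(m; z, \delta) = \{\gamma \in \mathcal{O} : |N_{F/\mathbb{Q}}(\operatorname{nr}(\gamma))| = m,\ d(z, \varphi_0(\gamma) z) < \delta\}.$$ This set is stable under multiplication by $\mathfrak{o}_F^\times$; let $\# \mathcal{O}(m; z, \delta)$ be the number of its elements modulo $\mathfrak{o}_F^\times$. If $0 < \delta \leq B$ and $\delta \leq c\, D^{1-\varepsilon} m^{-6-\varepsilon}$, then $\# \mathcal{O}(m; z, \delta)$ is finite and $$\# \mathcal{O}(m; z, \delta) \leq C\, m^{\varepsilon}.$$ -/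

import Mathlib

open NumberField TensorProduct

namespace QuatCount

universe u v

section RealPlaces

variable {F : Type u} [Field F]

/-- A copy of `ℝ`, regarded as an extension field of `F` through the embedding `σ : F →+* ℝ`. -/
def RealAt (_σ : F →+* ℝ) : Type := ℝ

variable (σ : F →+* ℝ)

noncomputable instance : Field (RealAt σ) := inferInstanceAs (Field ℝ)

noncomputable instance : Algebra ℝ (RealAt σ) := inferInstanceAs (Algebra ℝ ℝ)

noncomputable instance : Algebra F (RealAt σ) := RingHom.toAlgebra (S := ℝ) σ

end RealPlaces

section Quaternion

variable {F : Type u} [Field F] {A : Type v} [Ring A] [Algebra F A]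

/-- The reduced trace on a central simple algebra `A` of dimension `4` over a field `F` of
characteristic `≠ 2`: half the trace of left multiplication. -/
noncomputable def trd (a : A) : F := LinearMap.trace F A (LinearMap.mulLeft F a) / 2

/-- The reduced norm on a central simple algebra `A` of dimension `4` over a field `F` of
characteristic `≠ 2`; compare `det M = (tr(M)² - tr(M²)) / 2` for a `2 × 2` matrix `M`. -/
noncomputable def nrd (a : A) : F := ((trd a : F) ^ 2 - trd (a * a)) / 2

/-- The projection `A → M₂(ℝ)`, `a ↦ e (1 ⊗ a)`, to the split real place `σ` given by a
splitting `e`. -/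
noncomputable def splitProj {σ : F →+* ℝ}
    (e : (RealAt σ ⊗[F] A) ≃ₐ[ℝ] Matrix (Fin 2) (Fin 2) ℝ) (a : A) :
    Matrix (Fin 2) (Fin 2) ℝ :=
  e (1 ⊗ₜ[F] a)

end Quaternion

section Compatibility

theorem trace_mulLeft_matrix (M : Matrix (Fin 2) (Fin 2) ℝ) : LinearMap.trace ℝ _ (LinearMap.mulLeft ℝ M) = 2 * M.trace := by
  rw [LinearMap.trace_eq_matrix_trace ℝ (Matrix.stdBasis ℝ (Fin 2) (Fin 2))]
  have h : ∀ i j k l, (Matrix.stdBasis ℝ (Fin 2) (Fin 2)).repr (M * Matrix.single i j 1) (k, l)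
      = (M * Matrix.single i j (1 : ℝ)) k l := fun _ _ _ _ => rfl
  simp only [Matrix.trace, Matrix.diag, LinearMap.toMatrix_apply, Fintype.sum_prod_type,
    Matrix.stdBasis_eq_single, LinearMap.mulLeft_apply, h, Fin.sum_univ_two]
  simp
  ring

/-- The reduced trace is the trace of the image in `M₂(ℝ)`. -/
theorem trace_splitProj {F : Type u} {A : Type v} [Field F] [CharZero F] [Ring A] [Algebra F A] [Module.Finite F A] {σ : F →+* ℝ}
    (e : (RealAt σ ⊗[F] A) ≃ₐ[ℝ] Matrix (Fin 2) (Fin 2) ℝ) (a : A) :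
    (splitProj e a).trace = σ (trd a) := by
  have h1 : LinearMap.trace (RealAt σ) (RealAt σ ⊗[F] A) ((LinearMap.mulLeft F a).baseChange (RealAt σ)) = algebraMap F (RealAt σ) (LinearMap.trace F A (LinearMap.mulLeft F a)) := LinearMap.trace_baseChange _ _
  have h2 : (LinearMap.mulLeft F a).baseChange (RealAt σ) = LinearMap.mulLeft (RealAt σ) ((1 : RealAt σ) ⊗ₜ[F] a) := by
    ext x; simp
  have h3 : LinearMap.trace ℝ _ (LinearMap.mulLeft ℝ ((1 : RealAt σ) ⊗ₜ[F] a)) = LinearMap.trace ℝ _ (LinearMap.mulLeft ℝ (splitProj e a)) := by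
    rw [← LinearMap.trace_conj' _ e.toLinearEquiv]
    congr 1
    ext x : 1
    simp [LinearEquiv.conj_apply, splitProj]
  have h4 : LinearMap.trace ℝ (RealAt σ ⊗[F] A) (LinearMap.mulLeft ℝ ((1 : RealAt σ) ⊗ₜ[F] a)) = LinearMap.trace (RealAt σ) _ (LinearMap.mulLeft (RealAt σ) ((1 : RealAt σ) ⊗ₜ[F] a)) := rfl
  have h5 : LinearMap.trace ℝ _ (LinearMap.mulLeft ℝ (splitProj e a)) = σ (LinearMap.trace F A (LinearMap.mulLeft F a)) := by
    rw [← h3, h4, ← h2, h1]; rfl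
  rw [trace_mulLeft_matrix] at h5
  rw [trd, map_div₀, ← h5, map_ofNat σ 2]; ring

/-- The reduced norm is the determinant of the image in `M₂(ℝ)`. -/
theorem det_splitProj {F : Type u} {A : Type v} [Field F] [CharZero F] [Ring A] [Algebra F A] [Module.Finite F A] {σ : F →+* ℝ}
    (e : (RealAt σ ⊗[F] A) ≃ₐ[ℝ] Matrix (Fin 2) (Fin 2) ℝ) (a : A) :
    (splitProj e a).det = σ (nrd a) := by
  have hm : splitProj e (a * a) = splitProj e a * splitProj e a := by
    rw [splitProj, splitProj, ← map_mul, Algebra.TensorProduct.tmul_mul_tmul, one_mul]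
  rw [nrd, map_div₀, map_sub, map_pow, ← trace_splitProj e, ← trace_splitProj e, hm]
  simp [Matrix.det_fin_two, Matrix.trace, Matrix.mul_apply, map_ofNat]
  ring

end Compatibility

section Orders

variable {F : Type u} [Field F] {A : Type v} [Ring A] [Algebra F A]

/-- An `𝓞 F`-order in `A`: a subring with `1`, stable under `𝓞 F`, which is a full
`𝓞 F`-lattice, i.e. finitely generated over `𝓞 F` and spanning `A` over `F`. -/
def IsOrder (O : Subalgebra (𝓞 F) A) : Prop :=
  (Subalgebra.toSubmodule O).FG ∧ Submodule.span F (O : Set A) = ⊤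

/-- The discriminant ideal of an order `O` in a quaternion algebra: the ideal of `𝓞 F` generated
by all `det (trd (xᵢ xⱼ))` with `x₁, …, x₄ ∈ O`. -/
noncomputable def disc (O : Subalgebra (𝓞 F) A) : Ideal (𝓞 F) :=
  Ideal.span {d : 𝓞 F | ∃ x : Fin 4 → A, (∀ i, x i ∈ O) ∧
    (d : F) = (Matrix.of fun i j => (trd (x i * x j) : F)).det}

/-- The absolute norm `D` of the discriminant ideal. -/
noncomputable def discNorm [NumberField F] (O : Subalgebra (𝓞 F) A) : ℕ :=
  Ideal.absNorm (disc O)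

/-- `𝒪(m; z, δ)`: the `γ ∈ O` with `|N_{F/ℚ}(nrd γ)| = m` whose image `g` in `GL₂(ℝ)` moves the
point `z` of the upper half-plane by a hyperbolic distance less than `δ`. Scalar matrices act
trivially, so `g` has the same action as its normalisation `|det g|^(-1/2) • g`. -/
def countSet [NumberField F] {σ : F →+* ℝ} (e : (RealAt σ ⊗[F] A) ≃ₐ[ℝ] Matrix (Fin 2) (Fin 2) ℝ)
    (O : Subalgebra (𝓞 F) A) (m : ℕ) (z : UpperHalfPlane) (δ : ℝ) : Set A :=
  {γ | γ ∈ O ∧ |Algebra.norm ℚ (nrd γ : F)| = m ∧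
    ∃ g : GL (Fin 2) ℝ, (g : Matrix (Fin 2) (Fin 2) ℝ) = splitProj e γ ∧ dist z (g • z) < δ}

/-- The set of classes of elements of `S` modulo multiplication by units of `𝓞 F`. -/
def unitClasses (S : Set A) : Set (MulAction.orbitRel.Quotient (𝓞 F)ˣ A) :=
  (fun γ : A => (Quotient.mk'' γ : MulAction.orbitRel.Quotient (𝓞 F)ˣ A)) '' S

end Orders

end QuatCount

/-! The count rests on a dichotomy for triples of elements of the counted set whose reduced norms
have the same sign at the split place: the quotients `x₀⁻¹x₁` and `x₀⁻¹x₂` either commute or they do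
not.

Suppose some such triple has quotients `a`, `c` that do not commute. Both have positive determinant
and nearly fix the same point, so they are close to rotations about it. Rotations commute, so the
determinant of the commutator is `O(δ²)` at the split place. At the quaternion places
multiplicativity of the norm costs only a factor 4, hence `N(nrd(ac - ca)) = O(δ²)`. The elements
`x₀, x₁, x₂, x₁x̄₀x₂` of the order have Gram determinant `-(nrd(x₀)³ nrd(ac - ca))²`, which gives `D
≤ K δ⁴ m⁶` (`exists_discNorm_le_of_not_commute`). With the assumed bound on `δ` this bounds `m`
(`rpow_le_of_le_mul`). Elements of bounded norm and displacement are boundedly many up to units, by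
packing in real coordinates (`exists_unitCover_of_norm_le`).

Suppose instead that all these quotients commute. For each sign they lie in a subfield `E` of degree
at most 4 over `F`. Multiplying by the conjugate of a base element turns the elements into integers
of `E` dividing `m²`. The divisor bound leaves `O(m^ε)` ideals. Elements with the same ideal differ
by units of `E` of bounded displacement, and the packing bound with norm 1 applies to those
(`exists_unitCover_of_commute`).

All constants must be uniform in the algebra, so every estimate passes through `RealFrame`, which
records only ring homomorphisms to the real completions and their compatibility with trace and norm.
-/

namespace QuatCount

/-! ### The action of `GL₂(ℝ)` on the upper half-plane and displacement of `i`. -/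

section Hyperbolic

open UpperHalfPlane

theorem im_gl_smul (g : GL (Fin 2) ℝ) (z : ℍ) :
    (g • z).im = |g.det.val| * z.im / ‖denom g z‖ ^ 2 := by
  rw [← Complex.normSq_eq_norm_sq]
  exact smulAux'_im g z

theorem dist_coe_gl_smul (g : GL (Fin 2) ℝ) (z w : ℍ) :
    dist ((g • z : ℍ) : ℂ) (g • w : ℍ) =
      |g.det.val| * dist (z : ℂ) w / (‖denom g z‖ * ‖denom g w‖) := by
  have hz := denom_ne_zero g z
  have hw := denom_ne_zero g w
  have key : num g z / denom g z - num g w / denom g w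
      = (g.det.val : ℂ) * ((z : ℂ) - w) / (denom g z * denom g w) := by
    field_simp
    simp only [num, denom, Matrix.GeneralLinearGroup.val_det_apply, Matrix.det_fin_two]
    push_cast
    ring
  rw [coe_smul, coe_smul, dist_eq_norm, ← map_sub, norm_σ, key, dist_eq_norm]
  simp [Complex.norm_real]

/-- The action of `GL₂(ℝ)` on the upper half-plane is isometric. -/
theorem dist_gl_smul (g : GL (Fin 2) ℝ) (z w : ℍ) : dist (g • z) (g • w) = dist z w := by
  have hz := norm_pos_iff.2 (denom_ne_zero g z)
  have hw := norm_pos_iff.2 (denom_ne_zero g w)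
  have hd : 0 < |g.det.val| := abs_pos.2 g.det.ne_zero
  have hzi := z.im_pos
  have hwi := w.im_pos
  have h : Real.cosh (dist (g • z) (g • w)) = Real.cosh (dist z w) := by
    rw [cosh_dist, cosh_dist, dist_coe_gl_smul, im_gl_smul, im_gl_smul]
    field_simp
  rw [← abs_of_nonneg (dist_nonneg : 0 ≤ dist (g • z) (g • w)),
    ← abs_of_nonneg (dist_nonneg : 0 ≤ dist z w)]
  exact le_antisymm (Real.cosh_le_cosh.1 h.le) (Real.cosh_le_cosh.1 h.ge)

/-- This turns displacement of `i` into a Frobenius norm, so all later estimates are polynomial in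
the entries. Matrices of negative determinant act through complex conjugation and obey the same
formula. -/
theorem cosh_dist_I_gl_smul (g : GL (Fin 2) ℝ) :
    2 * |g.det.val| * Real.cosh (dist I (g • I)) =
      g 0 0 ^ 2 + g 0 1 ^ 2 + g 1 0 ^ 2 + g 1 1 ^ 2 := by
  have hz := norm_pos_iff.2 (denom_ne_zero g I)
  have hd : 0 < |g.det.val| := abs_pos.2 g.det.ne_zero
  have hden : ‖denom g I‖ ^ 2 = g 1 0 ^ 2 + g 1 1 ^ 2 := by
    rw [← Complex.normSq_eq_norm_sq]
    simp [denom, Complex.normSq_apply]; ring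
  have key : dist (I : ℂ) (g • I : ℍ) ^ 2 * ‖denom g I‖ ^ 2
      = g 0 0 ^ 2 + g 0 1 ^ 2 + g 1 0 ^ 2 + g 1 1 ^ 2 - 2 * |g.det.val| := by
    rw [dist_eq_norm, ← mul_pow, coe_smul]
    rcases g.det_ne_zero.lt_or_gt with h | h
    · have hσ : ∀ x, σ g x = (starRingEnd ℂ) x := by intro x; simp [σ, not_lt.2 h.le]
      have h1 : ‖denom g I‖ = ‖(starRingEnd ℂ) (denom g I)‖ := by simp
      have h2 : (starRingEnd ℂ) (denom g I) ≠ 0 := by simpa using denom_ne_zero g I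
      rw [hσ, map_div₀, h1, ← norm_mul, sub_mul, div_mul_cancel₀ _ h2, ← Complex.normSq_eq_norm_sq,
        Matrix.GeneralLinearGroup.val_det_apply, abs_of_neg h, Matrix.det_fin_two]
      simp [num, denom, Complex.normSq_apply]
      ring
    · have hσ : ∀ x, σ g x = x := by intro x; simp [σ, h]
      rw [hσ, ← norm_mul, sub_mul, div_mul_cancel₀ _ (denom_ne_zero g I), ← Complex.normSq_eq_norm_sq,
        Matrix.GeneralLinearGroup.val_det_apply, abs_of_pos h, Matrix.det_fin_two]
      simp [num, denom, Complex.normSq_apply]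
      ring
  rw [cosh_dist, im_gl_smul]
  have hI : I.im = 1 := by simp
  rw [hI]
  field_simp
  linarith

end Hyperbolic

/-! ### Matrices that move `i` little, and their commutators. -/

section Displacement

open UpperHalfPlane

/-- The matrix `M` is invertible and moves the point `i` of the upper half-plane by a hyperbolic
distance less than `δ`. -/
def MovesLess (M : Matrix (Fin 2) (Fin 2) ℝ) (δ : ℝ) : Prop :=
  ∃ g : GL (Fin 2) ℝ, (g : Matrix (Fin 2) (Fin 2) ℝ) = M ∧ dist I (g • I) < δ

variable {M N U V : Matrix (Fin 2) (Fin 2) ℝ} {δ : ℝ}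

theorem MovesLess.mono {δ' : ℝ} (h : MovesLess M δ) (hδ : δ ≤ δ') : MovesLess M δ' := by
  obtain ⟨g, hg, h⟩ := h
  exact ⟨g, hg, h.trans_le hδ⟩

/-- Since `U = M⁻¹N` and `M` acts isometrically, `U` moves `i` as far as the images of `i` under `M`
and `N` are apart. -/
theorem MovesLess.of_mul_eq (hM : MovesLess M δ) (hN : MovesLess N δ) (h : M * U = N) :
    MovesLess U (2 * δ) := by
  obtain ⟨g, rfl, hg⟩ := hM
  obtain ⟨k, rfl, hk⟩ := hN
  refine ⟨g⁻¹ * k, ?_, ?_⟩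
  · rw [Units.val_mul, ← h, ← mul_assoc, ← Units.val_mul, inv_mul_cancel, Units.val_one, one_mul]
  · rw [← dist_gl_smul g, mul_smul, smul_inv_smul]
    calc _ ≤ dist (g • I) I + dist I (k • I) := dist_triangle _ _ _
      _ < _ := by rw [dist_comm]; linarith

theorem MovesLess.smul (hM : MovesLess M δ) {a : ℝ} (ha : a ≠ 0) : MovesLess (a • M) δ := by
  obtain ⟨g, rfl, hg⟩ := hM
  refine ⟨Matrix.GeneralLinearGroup.mkOfDetNeZero (a • g : Matrix (Fin 2) (Fin 2) ℝ) ?_, rfl, ?_⟩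
  · rw [Matrix.det_smul]
    exact mul_ne_zero (pow_ne_zero _ ha) g.det_ne_zero
  · set k := Matrix.GeneralLinearGroup.mkOfDetNeZero (a • g : Matrix (Fin 2) (Fin 2) ℝ) _
    have hk : (k : Matrix (Fin 2) (Fin 2) ℝ) = a • g := rfl
    have hdet : |k.det.val| = a ^ 2 * |g.det.val| := by
      rw [Matrix.GeneralLinearGroup.val_det_apply, Matrix.GeneralLinearGroup.val_det_apply, hk,
        Matrix.det_smul, abs_mul, Fintype.card_fin, abs_of_nonneg (sq_nonneg a)]
    have h1 := cosh_dist_I_gl_smul k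
    have h2 := cosh_dist_I_gl_smul g
    have hg0 : 0 < |g.det.val| := abs_pos.2 g.det.ne_zero
    have ha2 : 0 < a ^ 2 := by positivity
    rw [hdet, hk] at h1
    simp only [Matrix.smul_apply, smul_eq_mul, mul_pow] at h1
    have h3 : Real.cosh (dist I (k • I)) = Real.cosh (dist I (g • I)) := by
      have : 2 * (a ^ 2 * |g.det.val|) * Real.cosh (dist I (k • I)) =
        2 * (a ^ 2 * |g.det.val|) * Real.cosh (dist I (g • I)) := by
        rw [h1]; linear_combination - a ^ 2 * h2
      exact mul_left_cancel₀ (by positivity) this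
    have h4 := Real.cosh_le_cosh.1 h3.le
    rw [abs_of_nonneg dist_nonneg, abs_of_nonneg dist_nonneg] at h4
    exact h4.trans_lt hg

theorem MovesLess.sum_sq_le (hM : MovesLess M δ) :
    M 0 0 ^ 2 + M 0 1 ^ 2 + M 1 0 ^ 2 + M 1 1 ^ 2 ≤ 2 * |M.det| * Real.cosh δ := by
  obtain ⟨g, rfl, hg⟩ := hM
  rw [← cosh_dist_I_gl_smul g, Matrix.GeneralLinearGroup.val_det_apply]
  have h : Real.cosh (dist I (g • I)) ≤ Real.cosh δ := by
    rw [Real.cosh_le_cosh, abs_of_nonneg dist_nonneg]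
    exact hg.le.trans (le_abs_self _)
  gcongr

/-- Combines `cosh t ≤ exp (t²/2)` with `exp s - 1 ≤ s exp s` at `s = t²/2`. -/
theorem cosh_sub_one_le {t b : ℝ} (h0 : 0 ≤ t) (hb : t ≤ b) :
    Real.cosh t - 1 ≤ t ^ 2 * Real.exp (b ^ 2) := by
  have h1 := Real.cosh_le_exp_half_sq t
  have h2 : Real.exp (t ^ 2 / 2) ≤ Real.exp (b ^ 2) := Real.exp_le_exp.2 (by nlinarith)
  have h3 : 1 - t ^ 2 / 2 ≤ Real.exp (-(t ^ 2 / 2)) := by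
    linarith [Real.add_one_le_exp (-(t ^ 2 / 2))]
  have h4 : Real.exp (t ^ 2 / 2) * Real.exp (-(t ^ 2 / 2)) = 1 := by
    rw [← Real.exp_add]; simp
  have h5 := Real.exp_pos (t ^ 2 / 2)
  nlinarith [mul_le_mul_of_nonneg_left h3 h5.le, mul_le_mul_of_nonneg_left h2 (sq_nonneg t),
    mul_nonneg (sq_nonneg t) h5.le]

/-- The left side is the sum of squared entries minus `2 det`; it vanishes exactly on multiples of
rotations, the stabiliser of `i`. Hence it is at most `2 det (cosh δ - 1)`. -/
theorem MovesLess.off_rotation_le (hM : MovesLess M δ) (hdet : 0 < M.det) {b : ℝ} (h0 : 0 ≤ δ)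
    (hb : δ ≤ b) :
    (M 0 0 - M 1 1) ^ 2 + (M 0 1 + M 1 0) ^ 2 ≤ 2 * Real.exp (b ^ 2) * δ ^ 2 * M.det := by
  have h1 := hM.sum_sq_le
  have h2 := cosh_sub_one_le h0 hb
  rw [abs_of_pos hdet] at h1
  have h3 := mul_le_mul_of_nonneg_left h2 hdet.le
  have h4 := Matrix.det_fin_two M
  nlinarith

theorem MovesLess.rotation_le (hM : MovesLess M δ) (hdet : 0 < M.det) {b : ℝ} (h0 : 0 ≤ δ)
    (hb : δ ≤ b) : (M 0 1 - M 1 0) ^ 2 ≤ 4 * Real.cosh b * M.det := by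
  have h1 := hM.sum_sq_le
  rw [abs_of_pos hdet] at h1
  have h2 : Real.cosh δ ≤ Real.cosh b := by
    rw [Real.cosh_le_cosh, abs_of_nonneg h0]; exact hb.trans (le_abs_self _)
  have h3 := mul_le_mul_of_nonneg_left h2 hdet.le
  nlinarith [sq_nonneg (M 0 1 + M 1 0), sq_nonneg (M 0 0), sq_nonneg (M 1 1)]

/-- Here `x`, `y` stand for the off-rotation coordinates `M₀₀ - M₁₁`, `M₀₁ + M₁₀` and `r` for the
rotation coordinate `M₀₁ - M₁₀`. Every cross product contains an off-rotation coordinate, so a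
factor `κ`, of order `δ²`, comes out. -/
theorem abs_det_commutator_le_aux (x₁ y₁ r₁ x₂ y₂ r₂ κ l d₁ d₂ : ℝ) (hd₁ : 0 ≤ d₁) (hd₂ : 0 ≤ d₂)
    (hκ : 0 ≤ κ) (hl : 0 ≤ l)
    (h₁ : x₁ ^ 2 + y₁ ^ 2 ≤ κ * d₁) (h₂ : x₂ ^ 2 + y₂ ^ 2 ≤ κ * d₂) (hr₁ : r₁ ^ 2 ≤ l * d₁)
    (hr₂ : r₂ ^ 2 ≤ l * d₂) :
    |(x₁ * y₂ - x₂ * y₁) ^ 2 - ((r₁ * x₂ - r₂ * x₁) ^ 2 + (r₁ * y₂ - r₂ * y₁) ^ 2)| ≤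
      κ * (κ + 4 * l) * (d₁ * d₂) := by
  have a1 : (x₁ * y₂ - x₂ * y₁) ^ 2 ≤ (κ * d₁) * (κ * d₂) :=
    le_trans (by nlinarith [sq_nonneg (x₁ * x₂ + y₁ * y₂)])
      (mul_le_mul h₁ h₂ (by positivity) (by positivity))
  have a2 : r₁ ^ 2 * (x₂ ^ 2 + y₂ ^ 2) ≤ (l * d₁) * (κ * d₂) :=
    mul_le_mul hr₁ h₂ (by positivity) (by positivity)
  have a3 : r₂ ^ 2 * (x₁ ^ 2 + y₁ ^ 2) ≤ (l * d₂) * (κ * d₁) :=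
    mul_le_mul hr₂ h₁ (by positivity) (by positivity)
  have a4 : (r₁ * x₂ - r₂ * x₁) ^ 2 + (r₁ * y₂ - r₂ * y₁) ^ 2 ≤
      2 * (r₁ ^ 2 * (x₂ ^ 2 + y₂ ^ 2)) + 2 * (r₂ ^ 2 * (x₁ ^ 2 + y₁ ^ 2)) := by
    nlinarith [sq_nonneg (r₁ * x₂ + r₂ * x₁), sq_nonneg (r₁ * y₂ + r₂ * y₁)]
  have a5 : 0 ≤ κ * l * (d₁ * d₂) := by positivity
  have a6 : 0 ≤ κ * κ * (d₁ * d₂) := by positivity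
  rw [abs_le]
  constructor <;> nlinarith [sq_nonneg (x₁ * y₂ - x₂ * y₁), sq_nonneg (r₁ * x₂ - r₂ * x₁),
    sq_nonneg (r₁ * y₂ - r₂ * y₁)]

/-- Two matrices of positive determinant that almost fix the point `i` almost commute. -/
theorem exists_abs_det_commutator_le (b : ℝ) : ∃ K : ℝ, 0 < K ∧
    ∀ (δ : ℝ) (U V : Matrix (Fin 2) (Fin 2) ℝ), 0 ≤ δ → δ ≤ b → MovesLess U δ → MovesLess V δ →
      0 < U.det → 0 < V.det → |(U * V - V * U).det| ≤ K * δ ^ 2 * (U.det * V.det) := by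
  refine ⟨2 * Real.exp (b ^ 2) * (2 * Real.exp (b ^ 2) * b ^ 2 + 16 * Real.cosh b), ?_, ?_⟩
  · have := Real.cosh_pos b
    positivity
  · intro δ U V h0 hb hU hV hdU hdV
    have := Real.cosh_pos b
    have h := abs_det_commutator_le_aux _ _ _ _ _ _ (2 * Real.exp (b ^ 2) * δ ^ 2)
      (4 * Real.cosh b) U.det V.det hdU.le hdV.le (by positivity) (by positivity)
      (hU.off_rotation_le hdU h0 hb) (hV.off_rotation_le hdV h0 hb) (hU.rotation_le hdU h0 hb)
      (hV.rotation_le hdV h0 hb)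
    -- The commutator depends only on the traceless parts; in the coordinates above its determinant
    -- is a quarter of an indefinite form in their cross product.
    have e : (U * V - V * U).det = ((U 0 0 - U 1 1) * (V 0 1 + V 1 0) -
        (V 0 0 - V 1 1) * (U 0 1 + U 1 0)) ^ 2 / 4 -
        (((U 0 1 - U 1 0) * (V 0 0 - V 1 1) - (V 0 1 - V 1 0) * (U 0 0 - U 1 1)) ^ 2 +
        ((U 0 1 - U 1 0) * (V 0 1 + V 1 0) - (V 0 1 - V 1 0) * (U 0 1 + U 1 0)) ^ 2) / 4 := by
      simp [Matrix.det_fin_two, Matrix.mul_apply, Fin.sum_univ_two]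
      ring
    rw [e, ← sub_div, abs_div, abs_of_pos (by norm_num : (0 : ℝ) < 4)]
    refine (div_le_self (abs_nonneg _) (by norm_num)).trans (h.trans ?_)
    have h5 : δ ^ 2 ≤ b ^ 2 := by nlinarith
    have h6 : 2 * Real.exp (b ^ 2) * δ ^ 2 + 4 * (4 * Real.cosh b) ≤
        2 * Real.exp (b ^ 2) * b ^ 2 + 16 * Real.cosh b := by
      have := mul_le_mul_of_nonneg_left h5 (Real.exp_pos (b ^ 2)).le
      linarith
    calc _ ≤ 2 * Real.exp (b ^ 2) * δ ^ 2 * (2 * Real.exp (b ^ 2) * b ^ 2 + 16 * Real.cosh b)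
          * (U.det * V.det) := by gcongr
      _ = _ := by ring

end Displacement

/-! ### Gram determinants of the trace form on `M₂(ℝ)`. -/

section Gram

theorem det_fin_four (M : Matrix (Fin 4) (Fin 4) ℝ) :
    M.det =
      M 0 0 * (M 1 1 * (M 2 2 * M 3 3 - M 2 3 * M 3 2) - M 1 2 * (M 2 1 * M 3 3 - M 2 3 * M 3 1)
        + M 1 3 * (M 2 1 * M 3 2 - M 2 2 * M 3 1))
      - M 0 1 * (M 1 0 * (M 2 2 * M 3 3 - M 2 3 * M 3 2) - M 1 2 * (M 2 0 * M 3 3 - M 2 3 * M 3 0)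
        + M 1 3 * (M 2 0 * M 3 2 - M 2 2 * M 3 0))
      + M 0 2 * (M 1 0 * (M 2 1 * M 3 3 - M 2 3 * M 3 1) - M 1 1 * (M 2 0 * M 3 3 - M 2 3 * M 3 0)
        + M 1 3 * (M 2 0 * M 3 1 - M 2 1 * M 3 0))
      - M 0 3 * (M 1 0 * (M 2 1 * M 3 2 - M 2 2 * M 3 1) - M 1 1 * (M 2 0 * M 3 2 - M 2 2 * M 3 0)
        + M 1 2 * (M 2 0 * M 3 1 - M 2 1 * M 3 0)) := by
  rw [Matrix.det_succ_row_zero, Fin.sum_univ_four]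
  simp only [Matrix.det_fin_three, Matrix.submatrix_apply]
  have e1 : Fin.succ (0 : Fin 3) = 1 := rfl
  have e2 : Fin.succ (1 : Fin 3) = 2 := rfl
  have e3 : Fin.succ (2 : Fin 3) = 3 := rfl
  have f00 : Fin.succAbove (0 : Fin 4) 0 = 1 := rfl
  have f01 : Fin.succAbove (0 : Fin 4) 1 = 2 := rfl
  have f02 : Fin.succAbove (0 : Fin 4) 2 = 3 := rfl
  have f10 : Fin.succAbove (1 : Fin 4) 0 = 0 := rfl
  have f11 : Fin.succAbove (1 : Fin 4) 1 = 2 := rfl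
  have f12 : Fin.succAbove (1 : Fin 4) 2 = 3 := rfl
  have f20 : Fin.succAbove (2 : Fin 4) 0 = 0 := rfl
  have f21 : Fin.succAbove (2 : Fin 4) 1 = 1 := rfl
  have f22 : Fin.succAbove (2 : Fin 4) 2 = 3 := rfl
  have f30 : Fin.succAbove (3 : Fin 4) 0 = 0 := rfl
  have f31 : Fin.succAbove (3 : Fin 4) 1 = 1 := rfl
  have f32 : Fin.succAbove (3 : Fin 4) 2 = 2 := rfl
  have v0 : ((0 : Fin 4) : ℕ) = 0 := rfl
  have v1 : ((1 : Fin 4) : ℕ) = 1 := rfl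
  have v2 : ((2 : Fin 4) : ℕ) = 2 := rfl
  have v3 : ((3 : Fin 4) : ℕ) = 3 := rfl
  simp only [e1, e2, e3, f00, f01, f02, f10, f11, f12, f20, f21, f22, f30, f31, f32, v0, v1, v2,
    v3]
  ring


variable (G U V : Matrix (Fin 2) (Fin 2) ℝ)

/-- The matrix whose rows are the entries of four `2 × 2` matrices. -/
def entriesMatrix (x : Fin 4 → Matrix (Fin 2) (Fin 2) ℝ) : Matrix (Fin 4) (Fin 4) ℝ :=
  Matrix.of fun i => ![x i 0 0, x i 0 1, x i 1 0, x i 1 1]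

/-- In matrix units the trace form is the permutation matrix exchanging `E₀₁` and `E₁₀`, of
determinant `-1`. -/
theorem det_trace_mul (x : Fin 4 → Matrix (Fin 2) (Fin 2) ℝ) :
    (Matrix.of fun i j => (x i * x j).trace).det = -(entriesMatrix x).det ^ 2 := by
  have h : (Matrix.of fun i j => (x i * x j).trace) = entriesMatrix x *
      !![1, 0, 0, 0; 0, 0, 1, 0; 0, 1, 0, 0; 0, 0, 0, 1] * (entriesMatrix x).transpose := by
    ext i j
    simp [entriesMatrix, Matrix.mul_apply, Fin.sum_univ_four, Fin.sum_univ_two, Matrix.trace]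
    ring
  have hdet : (!![1, 0, 0, 0; 0, 0, 1, 0; 0, 1, 0, 0; 0, 0, 0, 1] :
      Matrix (Fin 4) (Fin 4) ℝ).det = -1 := by
    simp [det_fin_four]
  rw [h, Matrix.det_mul, Matrix.det_mul, Matrix.det_transpose, hdet]
  ring

/-- Left multiplication by `G` acts on the two columns separately, hence as two copies of `G`. -/
theorem det_entriesMatrix_mul_left (x : Fin 4 → Matrix (Fin 2) (Fin 2) ℝ) :
    (entriesMatrix fun i => G * x i).det = (entriesMatrix x).det * G.det ^ 2 := by
  have h : (entriesMatrix fun i => G * x i) = entriesMatrix x *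
      !![G 0 0, 0, G 1 0, 0; 0, G 0 0, 0, G 1 0; G 0 1, 0, G 1 1, 0; 0, G 0 1, 0, G 1 1] := by
    ext i j
    fin_cases j <;>
    simp [entriesMatrix, Matrix.mul_apply, Fin.sum_univ_four, Fin.sum_univ_two] <;> ring
  rw [h, Matrix.det_mul, Matrix.det_fin_two]
  congr 1
  simp [det_fin_four]
  ring

/-- This is where noncommutativity enters the discriminant: `1, U, V, UV` are a basis exactly when
the commutator is invertible. -/
theorem det_entriesMatrix_one (k : ℝ) :
    (entriesMatrix ![1, U, V, k • (U * V)]).det = k * (U * V - V * U).det := by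
  rw [det_fin_four, Matrix.det_fin_two]
  have h : ∀ i j, (U * V) i j = U i 0 * V 0 j + U i 1 * V 1 j := fun i j => by
    rw [Matrix.mul_apply, Fin.sum_univ_two]
  have h' : ∀ i j, (V * U) i j = V i 0 * U 0 j + V i 1 * U 1 j := fun i j => by
    rw [Matrix.mul_apply, Fin.sum_univ_two]
  simp only [entriesMatrix, Matrix.of_apply, Matrix.cons_val, Matrix.smul_apply, Matrix.sub_apply,
    h, h', smul_eq_mul, Matrix.one_apply_eq, Matrix.one_apply_ne, ne_eq, zero_ne_one, one_ne_zero,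
    not_false_eq_true]
  ring

theorem det_trace_commutator (k : ℝ) (x : Fin 4 → Matrix (Fin 2) (Fin 2) ℝ)
    (hx : x = ![G, G * U, G * V, k • (G * (U * V))]) :
    (Matrix.of fun i j => (x i * x j).trace).det =
      -(k * G.det ^ 2 * (U * V - V * U).det) ^ 2 := by
  have : x = fun i => G * ![1, U, V, k • (U * V)] i := by
    rw [hx]
    ext i : 1
    fin_cases i <;> simp
  rw [this, det_trace_mul, det_entriesMatrix_mul_left, det_entriesMatrix_one]
  ring

end Gram

/-! ### Reduced trace and norm at the real places. -/

section RealFrame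

universe u v

theorem trace_mulLeft_quaternionAlgebra (q : QuaternionAlgebra ℝ (-1) 0 (-1)) :
    LinearMap.trace ℝ _ (LinearMap.mulLeft ℝ q) = 4 * q.re := by
  rw [LinearMap.trace_eq_matrix_trace ℝ (QuaternionAlgebra.basisOneIJK (-1 : ℝ) 0 (-1))]
  have h : ∀ i : Fin 4, QuaternionAlgebra.basisOneIJK (-1 : ℝ) 0 (-1) i =
      ⟨(Pi.single i 1 : Fin 4 → ℝ) 0, (Pi.single i 1 : Fin 4 → ℝ) 1,
        (Pi.single i 1 : Fin 4 → ℝ) 2, (Pi.single i 1 : Fin 4 → ℝ) 3⟩ := fun i => by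
    rw [QuaternionAlgebra.basisOneIJK, Module.Basis.coe_ofEquivFun]
    rfl
  simp [Matrix.trace, Matrix.diag, LinearMap.toMatrix_apply, Fin.sum_univ_four, h]
  ring

theorem trace_mulLeft_quaternion (q : Quaternion ℝ) :
    LinearMap.trace ℝ _ (LinearMap.mulLeft ℝ q) = 4 * q.re :=
  trace_mulLeft_quaternionAlgebra q

variable {F : Type u} [Field F] {A : Type v}

theorem trace_mulLeft_equiv [Ring A] [Algebra F A] [Module.Finite F A] {σ : F →+* ℝ}
    {R : Type*} [Ring R] [Algebra ℝ R] (e : (RealAt σ ⊗[F] A) ≃ₐ[ℝ] R) (a : A) :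
    LinearMap.trace ℝ R (LinearMap.mulLeft ℝ (e (1 ⊗ₜ[F] a))) =
      σ (LinearMap.trace F A (LinearMap.mulLeft F a)) := by
  have h1 : LinearMap.trace (RealAt σ) (RealAt σ ⊗[F] A)
      ((LinearMap.mulLeft F a).baseChange (RealAt σ)) =
      algebraMap F (RealAt σ) (LinearMap.trace F A (LinearMap.mulLeft F a)) :=
    LinearMap.trace_baseChange _ _
  have h2 : (LinearMap.mulLeft F a).baseChange (RealAt σ) =
      LinearMap.mulLeft (RealAt σ) ((1 : RealAt σ) ⊗ₜ[F] a) := by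
    ext x; simp
  have h3 : LinearMap.trace ℝ _ (LinearMap.mulLeft ℝ ((1 : RealAt σ) ⊗ₜ[F] a)) =
      LinearMap.trace ℝ _ (LinearMap.mulLeft ℝ (e (1 ⊗ₜ[F] a))) := by
    rw [← LinearMap.trace_conj' _ e.toLinearEquiv]
    congr 1
    ext x : 1
    simp [LinearEquiv.conj_apply]
  have h4 : LinearMap.trace ℝ (RealAt σ ⊗[F] A) (LinearMap.mulLeft ℝ ((1 : RealAt σ) ⊗ₜ[F] a)) =
      LinearMap.trace (RealAt σ) _ (LinearMap.mulLeft (RealAt σ) ((1 : RealAt σ) ⊗ₜ[F] a)) := rfl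
  rw [← h3, h4, ← h2, h1]
  rfl

/-- The projection of `A` to the real algebra `R` at the place `σ`, as a ring homomorphism. -/
noncomputable def placeHom [Ring A] [Algebra F A] {σ : F →+* ℝ} {R : Type*} [Ring R] [Algebra ℝ R]
    (e : (RealAt σ ⊗[F] A) ≃ₐ[ℝ] R) : A →+* R :=
  (e : (RealAt σ ⊗[F] A) →+* R).comp
    (Algebra.TensorProduct.includeRight (R := F) (A := RealAt σ) (B := A)).toRingHom

theorem placeHom_apply [Ring A] [Algebra F A] {σ : F →+* ℝ} {R : Type*} [Ring R] [Algebra ℝ R]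
    (e : (RealAt σ ⊗[F] A) ≃ₐ[ℝ] R) (a : A) : placeHom e a = e (1 ⊗ₜ[F] a) := rfl

theorem placeHom_smul [Ring A] [Algebra F A] {σ : F →+* ℝ} {R : Type*} [Ring R] [Algebra ℝ R]
    (e : (RealAt σ ⊗[F] A) ≃ₐ[ℝ] R) (c : F) (a : A) : placeHom e (c • a) = σ c • placeHom e a := by
  have h : (1 : RealAt σ) ⊗ₜ[F] (c • a) = (σ c : ℝ) • ((1 : RealAt σ) ⊗ₜ[F] a) := by
    rw [TensorProduct.tmul_smul, TensorProduct.smul_tmul', TensorProduct.smul_tmul']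
    congr 1
  rw [placeHom_apply, h, map_smul, placeHom_apply]

theorem normSq_placeHom [CharZero F] [Ring A] [Algebra F A] [Module.Finite F A] {σ : F →+* ℝ}
    (e : (RealAt σ ⊗[F] A) ≃ₐ[ℝ] Quaternion ℝ) (a : A) :
    Quaternion.normSq (placeHom e a) = σ (nrd a) := by
  have ht : ∀ b : A, σ (trd b) = 2 * (placeHom e b).re := fun b => by
    have := trace_mulLeft_equiv e b
    rw [trace_mulLeft_quaternion, ← placeHom_apply] at this
    rw [trd, map_div₀, ← this, map_ofNat]
    ring
  rw [nrd, map_div₀, map_sub, map_pow, ht, ht, map_mul, map_ofNat, Quaternion.normSq_def']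
  simp [Quaternion.re_mul]
  ring

/-- Realisations of `A` at all real places of the totally real field `F`: by real matrices at
`σ₀`, by Hamilton's quaternions elsewhere. -/
structure RealFrame (F : Type u) [Field F] (A : Type v) [Ring A] [Algebra F A] (σ₀ : F →+* ℝ) where
  split : A →+* Matrix (Fin 2) (Fin 2) ℝ
  split_smul : ∀ (c : F) (a : A), split (c • a) = σ₀ c • split a
  split_trace : ∀ a : A, (split a).trace = σ₀ (trd a)
  split_det : ∀ a : A, (split a).det = σ₀ (nrd a)
  quat : ∀ σ : F →+* ℝ, σ ≠ σ₀ → A →+* Quaternion ℝ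
  normSq_quat : ∀ (σ : F →+* ℝ) (hσ : σ ≠ σ₀) (a : A), Quaternion.normSq (quat σ hσ a) = σ (nrd a)

/-- A frame in which the given point `z` of the upper half-plane becomes `i`. -/
theorem exists_realFrame [CharZero F] [Ring A] [Algebra F A] [Module.Finite F A] {σ₀ : F →+* ℝ}
    (e : (RealAt σ₀ ⊗[F] A) ≃ₐ[ℝ] Matrix (Fin 2) (Fin 2) ℝ)
    (he : ∀ σ : F →+* ℝ, σ ≠ σ₀ → Nonempty ((RealAt σ ⊗[F] A) ≃ₐ[ℝ] Quaternion ℝ))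
    (z : UpperHalfPlane) :
    ∃ R : RealFrame F A σ₀, ∀ (a : A) (δ : ℝ),
      (∃ g : GL (Fin 2) ℝ, (g : Matrix (Fin 2) (Fin 2) ℝ) = splitProj e a ∧ dist z (g • z) < δ) →
        MovesLess (R.split a) δ := by
  have q : ∀ σ : F →+* ℝ, σ ≠ σ₀ → ((RealAt σ ⊗[F] A) ≃ₐ[ℝ] Quaternion ℝ) :=
    fun σ hσ => (he σ hσ).some
  -- `SL₂(ℝ)` is transitive on the half-plane; conjugating by an element carrying `i` to `z` moves
  -- the base point to `i` and preserves trace and determinant.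
  obtain ⟨s, hs⟩ := MulAction.exists_smul_eq (Matrix.SpecialLinearGroup (Fin 2) ℝ)
    UpperHalfPlane.I z
  set h : GL (Fin 2) ℝ := (s : GL (Fin 2) ℝ) with hh
  have hz : h • UpperHalfPlane.I = z := hs
  let c : Matrix (Fin 2) (Fin 2) ℝ →+* Matrix (Fin 2) (Fin 2) ℝ :=
    ((MulSemiringAction.toRingHom (ConjAct (GL (Fin 2) ℝ)) _) (ConjAct.toConjAct h⁻¹))
  have hc : ∀ x, c x = (h⁻¹ : GL (Fin 2) ℝ).1 * x * h.1 := fun x => by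
    change ConjAct.toConjAct h⁻¹ • x = _
    rw [ConjAct.units_smul_def]
    simp
  have hinv : h.1 * (h⁻¹ : GL (Fin 2) ℝ).1 = 1 := by rw [← Units.val_mul]; simp
  refine ⟨⟨c.comp (placeHom e), ?_, ?_, ?_, fun σ hσ => placeHom (q σ hσ), ?_⟩, ?_⟩
  · intro a x
    simp [hc, placeHom_smul]
  · intro a
    rw [RingHom.comp_apply, hc, Matrix.trace_mul_comm, ← mul_assoc, hinv, one_mul]
    exact trace_splitProj e a
  · intro a
    rw [RingHom.comp_apply, hc, Matrix.det_mul, Matrix.det_mul, mul_right_comm, ← Matrix.det_mul,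
      mul_comm, ← Units.val_mul, inv_mul_cancel, Units.val_one, Matrix.det_one, mul_one]
    exact det_splitProj e a
  · intro σ hσ a
    exact normSq_placeHom _ a
  · rintro a δ ⟨g, hg, hd⟩
    refine ⟨h⁻¹ * g * h, ?_, ?_⟩
    · rw [RingHom.comp_apply, hc, Units.val_mul, Units.val_mul, hg]
      rfl
    · rw [mul_smul, mul_smul, hz, ← dist_gl_smul h, smul_inv_smul, hz]
      exact hd

end RealFrame

/-! ### Algebra of the reduced norm, and integrality. -/

section FrameAlgebra

universe u v

variable {F : Type u} [Field F] {A : Type v} [DivisionRing A] [Algebra F A] {σ₀ : F →+* ℝ}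

/-- Gauss's lemma: `𝓞 F` is integrally closed. -/
theorem exists_coe_eq_of_dvd_map [NumberField F] {f : Polynomial (𝓞 F)}
    (hf : f.Monic) {g : Polynomial F} (hg : g.Monic) (h : g ∣ f.map (algebraMap (𝓞 F) F)) (i : ℕ) :
    ∃ c : 𝓞 F, algebraMap (𝓞 F) F c = g.coeff i := by
  obtain ⟨g', hg'⟩ := IsIntegrallyClosed.eq_map_mul_C_of_dvd F hf h
  rw [hg.leadingCoeff, map_one, mul_one] at hg'
  exact ⟨g'.coeff i, by rw [← hg', Polynomial.coeff_map]⟩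

namespace RealFrame

variable (R : RealFrame F A σ₀)
include R

theorem split_injective : Function.Injective R.split := R.split.injective

theorem split_algebraMap (c : F) : R.split (algebraMap F A c) = σ₀ c • 1 := by
  rw [Algebra.algebraMap_eq_smul_one, R.split_smul, map_one]

theorem nrd_mul (a b : A) : (nrd (a * b) : F) = nrd a * nrd b := by
  apply σ₀.injective
  rw [map_mul, ← R.split_det, ← R.split_det, ← R.split_det, map_mul, Matrix.det_mul]

theorem nrd_one : (nrd (1 : A) : F) = 1 := by
  apply σ₀.injective
  rw [map_one, ← R.split_det, map_one, Matrix.det_one]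

theorem nrd_smul (c : F) (a : A) : (nrd (c • a) : F) = c ^ 2 * nrd a := by
  apply σ₀.injective
  rw [map_mul, map_pow, ← R.split_det, ← R.split_det, R.split_smul, Matrix.det_smul,
    Fintype.card_fin]

theorem trd_algebraMap (c : F) : (trd (algebraMap F A c) : F) = 2 * c := by
  apply σ₀.injective
  rw [← R.split_trace, R.split_algebraMap, map_mul, map_ofNat]
  simp
  ring

theorem nrd_algebraMap (c : F) : (nrd (algebraMap F A c) : F) = c ^ 2 := by
  rw [Algebra.algebraMap_eq_smul_one, R.nrd_smul, R.nrd_one, mul_one]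

theorem nrd_ne_zero {a : A} (ha : a ≠ 0) : (nrd a : F) ≠ 0 := by
  intro h
  have := R.nrd_mul a a⁻¹
  rw [mul_inv_cancel₀ ha, R.nrd_one, h, zero_mul] at this
  exact one_ne_zero this

theorem nrd_zero : (nrd (0 : A) : F) = 0 := by
  have := R.nrd_smul 0 (0 : A)
  simpa using this

/-- The Cayley–Hamilton identity. -/
theorem mul_trd_sub (a : A) :
    a * (algebraMap F A (trd a) - a) = algebraMap F A (nrd a) := by
  apply R.split_injective
  rw [map_mul, map_sub, R.split_algebraMap, R.split_algebraMap, ← R.split_trace, ← R.split_det]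
  ext i j
  fin_cases i <;> fin_cases j <;>
    simp [Matrix.mul_apply, Matrix.trace_fin_two, Matrix.det_fin_two] <;> ring

open Polynomial in
-- Outside `F` the polynomial `X² - trd(a)X + nrd(a)` is the minimal polynomial, so it divides a
-- monic integral one. Scalars have a linear minimal polynomial and are treated separately.
theorem exists_coe_eq_trd_nrd [NumberField F] {a : A} (ha : IsIntegral (𝓞 F) a) :
    (∃ t : 𝓞 F, algebraMap (𝓞 F) F t = trd a) ∧ ∃ n : 𝓞 F, algebraMap (𝓞 F) F n = nrd a := by
  by_cases hr : a ∈ (algebraMap F A).range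
  · obtain ⟨c, rfl⟩ := hr
    have hc : IsIntegral (𝓞 F) c :=
      (isIntegral_algebraMap_iff (algebraMap F A).injective).1 ha
    obtain ⟨y, hy⟩ := IsIntegrallyClosed.isIntegral_iff.1 hc
    rw [R.trd_algebraMap, R.nrd_algebraMap]
    exact ⟨⟨2 * y, by rw [map_mul, hy, map_ofNat]⟩, ⟨y ^ 2, by rw [map_pow, hy]⟩⟩
  · set Q : F[X] := X ^ 2 - C (trd a) * X + C (nrd a) with hQ
    have hQd : Q.natDegree = 2 := by rw [hQ]; compute_degree!
    have hQm : Q.Monic := by rw [hQ]; monicity!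
    have hQa : aeval a Q = 0 := by
      have := R.mul_trd_sub a
      rw [hQ]
      simp only [map_add, map_sub, map_mul, map_pow, aeval_X, aeval_C]
      rw [← this, mul_sub, Algebra.commutes]
      noncomm_ring
    have hint : IsIntegral F a := ⟨Q, hQm, hQa⟩
    have hmin : minpoly F a = Q := by
      symm
      refine eq_of_monic_of_dvd_of_natDegree_le (minpoly.monic hint) hQm (minpoly.dvd F a hQa) ?_
      rw [hQd]
      exact (minpoly.two_le_natDegree_iff hint).2 hr
    obtain ⟨f, hfm, hfa⟩ := ha
    have hdvd : Q ∣ f.map (algebraMap (𝓞 F) F) := by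
      rw [← hmin]
      refine minpoly.dvd F a ?_
      rw [aeval_map_algebraMap]
      exact hfa
    obtain ⟨t, ht⟩ := exists_coe_eq_of_dvd_map hfm hQm hdvd 1
    obtain ⟨n, hn⟩ := exists_coe_eq_of_dvd_map hfm hQm hdvd 0
    refine ⟨⟨-t, ?_⟩, ⟨n, ?_⟩⟩
    · rw [map_neg, ht, hQ]
      simp
    · rw [hn, hQ]
      simp

end RealFrame

end FrameAlgebra

/-! ### Norms as products over the real places. -/

section Places

universe u

variable {F : Type u} [Field F] [IsTotallyReal F]

/-- The real embedding attached to an infinite place of a totally real field. -/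
noncomputable def realEmb (w : InfinitePlace F) : F →+* ℝ :=
  InfinitePlace.embedding_of_isReal (IsTotallyReal.isReal w)

theorem abs_realEmb (w : InfinitePlace F) (x : F) : |realEmb w x| = w x :=
  InfinitePlace.norm_embedding_of_isReal _ x

theorem realEmb_injective : Function.Injective (realEmb (F := F)) := fun v w h => by
  ext x
  rw [← abs_realEmb, ← abs_realEmb, h]

theorem exists_realEmb_eq (σ : F →+* ℝ) : ∃ w : InfinitePlace F, realEmb w = σ := by
  refine ⟨InfinitePlace.mk (Complex.ofRealHom.comp σ), ?_⟩
  have hr : ComplexEmbedding.IsReal (Complex.ofRealHom.comp σ) := by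
    ext x
    simp
  ext x
  apply Complex.ofReal_injective
  rw [realEmb, InfinitePlace.embedding_of_isReal_apply, InfinitePlace.embedding_mk_eq_of_isReal hr]
  rfl

theorem abs_norm_eq_prod [NumberField F] (x : F) :
    ((|Algebra.norm ℚ x| : ℚ) : ℝ) = ∏ w : InfinitePlace F, |realEmb w x| := by
  rw [← InfinitePlace.prod_eq_abs_norm]
  exact Finset.prod_congr rfl fun w _ => by rw [abs_realEmb, IsTotallyReal.mult_eq, pow_one]

/-- Comparing norms by comparing absolute values at all real places. -/
theorem abs_norm_le_of_forall [NumberField F] {σ₀ : F →+* ℝ} {x y : F} {a b : ℝ} (ha : 0 ≤ a)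
    (h₀ : |σ₀ x| ≤ a * |σ₀ y|) (h : ∀ σ : F →+* ℝ, σ ≠ σ₀ → |σ x| ≤ b * |σ y|) :
    ((|Algebra.norm ℚ x| : ℚ) : ℝ) ≤
      a * b ^ (Fintype.card (InfinitePlace F) - 1) * ((|Algebra.norm ℚ y| : ℚ) : ℝ) := by
  classical
  obtain ⟨w₀, rfl⟩ := exists_realEmb_eq σ₀
  rw [abs_norm_eq_prod, abs_norm_eq_prod, ← Finset.mul_prod_erase _ _ (Finset.mem_univ w₀),
    ← Finset.mul_prod_erase _ (fun w => |realEmb w y|) (Finset.mem_univ w₀)]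
  have hp : ∏ w ∈ Finset.univ.erase w₀, |realEmb w x| ≤
      b ^ (Fintype.card (InfinitePlace F) - 1) * ∏ w ∈ Finset.univ.erase w₀, |realEmb w y| := by
    have hc : (Finset.univ.erase w₀).card = Fintype.card (InfinitePlace F) - 1 := by
      rw [Finset.card_erase_of_mem (Finset.mem_univ _), Finset.card_univ]
    rw [← hc, ← Finset.prod_const, ← Finset.prod_mul_distrib]
    refine Finset.prod_le_prod (fun _ _ => abs_nonneg _) fun w hw => h _ ?_
    exact fun he => Finset.ne_of_mem_erase hw (realEmb_injective he)
  calc _ ≤ (a * |realEmb w₀ y|) * (b ^ (Fintype.card (InfinitePlace F) - 1) *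
        ∏ w ∈ Finset.univ.erase w₀, |realEmb w y|) :=
        mul_le_mul h₀ hp (Finset.prod_nonneg fun _ _ => abs_nonneg _) (by positivity)
    _ = _ := by ring

omit [IsTotallyReal F] in
theorem one_le_abs_norm_coe [NumberField F] {x : 𝓞 F} (hx : x ≠ 0) : (1 : ℝ) ≤ ((|Algebra.norm ℚ (x : F)| : ℚ) : ℝ) := by
  rw [← Algebra.coe_norm_int]
  have h : Algebra.norm ℤ x ≠ 0 := Algebra.norm_ne_zero_iff.2 hx
  exact_mod_cast Int.one_le_abs h

end Places

/-! ### Packing in real coordinates, and reduction modulo squares of units. -/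

section Packing

universe u v

variable {F : Type u} [Field F] [IsTotallyReal F] {A : Type v} [DivisionRing A] [Algebra F A]
  {σ₀ : F →+* ℝ}

namespace RealFrame

open Classical in
/-- The four real coordinates of `a` at the place `w`. -/
noncomputable def coord (R : RealFrame F A σ₀) (w : InfinitePlace F) (a : A) : Fin 4 → ℝ :=
  if h : realEmb w = σ₀ then
    ![R.split a 0 0, R.split a 0 1, R.split a 1 0, R.split a 1 1]
  else ![(R.quat _ h a).re, (R.quat _ h a).imI, (R.quat _ h a).imJ, (R.quat _ h a).imK]

variable (R : RealFrame F A σ₀)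

theorem coord_sub (w : InfinitePlace F) (a b : A) (i : Fin 4) :
    R.coord w (a - b) i = R.coord w a i - R.coord w b i := by
  unfold coord
  split_ifs <;> fin_cases i <;> simp

theorem abs_nrd_le_of_coord_le (w : InfinitePlace F) (a : A) {s : ℝ}
    (h : ∀ i, |R.coord w a i| ≤ s) : |realEmb w (nrd a)| ≤ 4 * s ^ 2 := by
  have hs : 0 ≤ s := (abs_nonneg _).trans (h 0)
  have h' : ∀ i, R.coord w a i ^ 2 ≤ s ^ 2 := fun i => by
    rw [← sq_abs]; exact pow_le_pow_left₀ (abs_nonneg _) (h i) 2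
  have h0 := h' 0; have h1 := h' 1; have h2 := h' 2; have h3 := h' 3
  by_cases hw : realEmb w = σ₀
  · simp only [coord, hw, ↓reduceDIte, Matrix.cons_val] at h0 h1 h2 h3
    rw [hw, ← R.split_det, Matrix.det_fin_two, abs_le]
    constructor <;> nlinarith [sq_nonneg (R.split a 0 0 + R.split a 1 1),
      sq_nonneg (R.split a 0 0 - R.split a 1 1), sq_nonneg (R.split a 0 1 + R.split a 1 0),
      sq_nonneg (R.split a 0 1 - R.split a 1 0)]
  · simp only [coord, hw, ↓reduceDIte, Matrix.cons_val] at h0 h1 h2 h3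
    rw [← R.normSq_quat _ hw, abs_of_nonneg Quaternion.normSq_nonneg, Quaternion.normSq_def']
    linarith

/-- At the quaternion places the norm form is definite and bounds the coordinates by itself. The
determinant is indefinite, so the split place needs the displacement bound. -/
theorem coord_sq_le (w : InfinitePlace F) (a : A) {r b : ℝ} (hr : |realEmb w (nrd a)| ≤ r)
    (hb : MovesLess (R.split a) b) (i : Fin 4) : R.coord w a i ^ 2 ≤ 2 * r * Real.cosh b := by
  have hc := Real.one_le_cosh b
  have hr0 : 0 ≤ r := (abs_nonneg _).trans hr
  by_cases hw : realEmb w = σ₀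
  · rw [hw, ← R.split_det] at hr
    have h1 := hb.sum_sq_le
    have h2 : 2 * |(R.split a).det| * Real.cosh b ≤ 2 * r * Real.cosh b := by gcongr
    fin_cases i <;> simp only [coord, hw, ↓reduceDIte, Fin.zero_eta, Fin.mk_one, Fin.reduceFinMk,
      Matrix.cons_val] <;> nlinarith [sq_nonneg (R.split a 0 0), sq_nonneg (R.split a 0 1),
      sq_nonneg (R.split a 1 0), sq_nonneg (R.split a 1 1)]
  · rw [← R.normSq_quat _ hw, abs_of_nonneg Quaternion.normSq_nonneg,
      Quaternion.normSq_def'] at hr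
    have h2 : r ≤ 2 * r * Real.cosh b := by nlinarith
    fin_cases i <;> simp only [coord, hw, ↓reduceDIte, Fin.zero_eta, Fin.mk_one, Fin.reduceFinMk,
      Matrix.cons_val] <;> nlinarith [sq_nonneg (R.quat _ hw a).re, sq_nonneg (R.quat _ hw a).imI,
      sq_nonneg (R.quat _ hw a).imJ, sq_nonneg (R.quat _ hw a).imK]

end RealFrame

/-- The elements of `A` in a given bounded region whose pairwise differences have norm at least `1`
are boundedly many, uniformly in `A`. -/
theorem exists_packing_bound (F : Type u) [Field F] [NumberField F] [IsTotallyReal F] (r b : ℝ) :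
    ∃ C : ℕ, ∀ (A : Type v) [DivisionRing A] [Algebra F A] (σ₀ : F →+* ℝ) (R : RealFrame F A σ₀)
      (T : Set A),
      (∀ x ∈ T, ∀ y ∈ T, x ≠ y → (1 : ℝ) ≤ ((|Algebra.norm ℚ (nrd (x - y) : F)| : ℚ) : ℝ)) →
      (∀ x ∈ T, ∀ w : InfinitePlace F, |realEmb w (nrd x)| ≤ r) →
      (∀ x ∈ T, MovesLess (R.split x) b) → T.Finite ∧ T.ncard ≤ C := by
  classical
  set L : ℝ := 1 + |2 * r * Real.cosh b| with hL
  set K : ℤ := ⌈4 * L⌉ with hK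
  let P : Finset (InfinitePlace F × Fin 4 → ℤ) := Fintype.piFinset fun _ => Finset.Icc (-K) K
  refine ⟨P.card, fun A _ _ σ₀ R T hT hr hb => ?_⟩
  -- The region is cut into cells of side `1/4`. Two points in one cell have a difference whose
  -- reduced norm is at most `4 · (1/4)² = 1/4` at every place, so its norm is below 1.
  let f : A → (InfinitePlace F × Fin 4 → ℤ) := fun a p => ⌊4 * R.coord p.1 a p.2⌋
  have hmaps : ∀ a ∈ T, f a ∈ (P : Set _) := by
    intro a ha
    refine Finset.mem_coe.2 (Fintype.mem_piFinset.2 fun p => ?_)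
    have h1 := R.coord_sq_le p.1 a (hr a ha p.1) (hb a ha) p.2
    have h2 : |R.coord p.1 a p.2| ≤ L := by
      refine abs_le_of_sq_le_sq (h1.trans ?_) (by positivity)
      nlinarith [le_abs_self (2 * r * Real.cosh b), abs_nonneg (2 * r * Real.cosh b)]
    obtain ⟨h3, h4⟩ := abs_le.1 h2
    have h5 : 4 * L ≤ K := Int.le_ceil _
    rw [Finset.mem_Icc]
    constructor
    · rw [Int.le_floor]
      push_cast
      linarith
    · have : ((f a p : ℤ) : ℝ) ≤ K := (Int.floor_le _).trans (by linarith)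
      exact_mod_cast this
  have hinj : Set.InjOn f T := by
    intro x hx y hy hxy
    by_contra hne
    have h1 := hT x hx y hy hne
    have h2 : ∀ w : InfinitePlace F, |realEmb w (nrd (x - y))| ≤ 1 / 4 := by
      intro w
      have := R.abs_nrd_le_of_coord_le w (x - y) (s := 1 / 4) fun i => by
        have h3 := Int.abs_sub_lt_one_of_floor_eq_floor (congrFun hxy (w, i))
        rw [R.coord_sub]
        rw [abs_le]
        rw [abs_lt] at h3
        constructor <;> linarith [h3.1, h3.2]
      norm_num at this ⊢
      exact this
    rw [abs_norm_eq_prod] at h1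
    have h3 : ∏ w : InfinitePlace F, |realEmb w (nrd (x - y))| ≤
        ∏ _w : InfinitePlace F, (1 / 4 : ℝ) :=
      Finset.prod_le_prod (fun _ _ => abs_nonneg _) fun w _ => h2 w
    rw [Finset.prod_const, Finset.card_univ] at h3
    have h4 : (1 / 4 : ℝ) ^ Fintype.card (InfinitePlace F) < 1 :=
      pow_lt_one₀ (by norm_num) (by norm_num) Fintype.card_ne_zero
    linarith
  refine ⟨Set.Finite.of_injOn hmaps hinj P.finite_toSet, ?_⟩
  rw [← Set.ncard_coe_finset P]
  exact Set.ncard_le_ncard_of_injOn f hmaps hinj P.finite_toSet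

/-- Modulo squares of units, the integers of bounded norm have bounded conjugates. -/
theorem exists_unit_sq_mul_le (F : Type u) [Field F] [NumberField F] (M : ℕ) :
    ∃ r : ℝ, ∀ y : 𝓞 F, y ≠ 0 → |Algebra.norm ℚ (algebraMap (𝓞 F) F y)| ≤ M →
      ∃ v : (𝓞 F)ˣ, ∀ w : InfinitePlace F, w ((v : F) ^ 2 * algebraMap (𝓞 F) F y) ≤ r := by
  classical
  -- Scaling by a unit `v` multiplies a reduced norm by `v²`, so only squares of units are
  -- available. The unit group is finitely generated, hence squares have finite index.
  let H := (powMonoidHom (α := (𝓞 F)ˣ) 2).range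
  have hfin : Finite ((𝓞 F)ˣ ⧸ H) := by
    have : Group.FG (𝓞 F)ˣ :=
      GroupFG.iff_add_fg.2 (Module.Finite.iff_addGroup_fg.1 inferInstance)
    have : H.FiniteIndex := Subgroup.finiteIndex_range_powMonoidHom_of_fg _ two_ne_zero
    infer_instance
  let S : Set (Ideal (𝓞 F)) := {I | Ideal.absNorm I ≤ M}
  have hS : S.Finite := Ideal.finite_setOfPred_absNorm_le M
  -- The default value 0 is never reached below: the ideals used are principal.
  let gen : Ideal (𝓞 F) → 𝓞 F := fun I =>
    if h : ∃ g, Ideal.span {g} = I then h.choose else 0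
  let val : (𝓞 F)ˣ ⧸ H → Ideal (𝓞 F) → InfinitePlace F → ℝ := fun q I w =>
    w (algebraMap (𝓞 F) F (q.out * gen I))
  -- Up to squares of units, `y` is a coset representative times a chosen generator of its ideal:
  -- finitely many possibilities, so a common bound `r` exists.
  have hB : (Set.range fun p : ((𝓞 F)ˣ ⧸ H) × S × InfinitePlace F =>
      val p.1 p.2.1 p.2.2).Finite := by
    have := hS.to_subtype
    exact Set.finite_range _
  obtain ⟨r, hr⟩ := hB.bddAbove
  refine ⟨r, fun y hy hM => ?_⟩
  let I : Ideal (𝓞 F) := Ideal.span {y}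
  have hI : I ∈ S := by
    change Ideal.absNorm (Ideal.span {y}) ≤ M
    rw [Ideal.absNorm_span_singleton]
    have h1 : ((|Algebra.norm ℤ y| : ℤ) : ℚ) ≤ M := by
      rw [Int.cast_abs, Algebra.coe_norm_int]; exact hM
    have h2 : |Algebra.norm ℤ y| ≤ M := by exact_mod_cast h1
    rw [Int.abs_eq_natAbs] at h2
    exact_mod_cast h2
  have hex : ∃ g, Ideal.span {g} = I := ⟨y, rfl⟩
  have hgen : Ideal.span {gen I} = Ideal.span {y} := by
    simp only [gen, dif_pos hex]
    exact hex.choose_spec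
  obtain ⟨u, hu⟩ := Ideal.span_singleton_eq_span_singleton.1 hgen
  obtain ⟨s, hs⟩ : ((QuotientGroup.mk u : (𝓞 F)ˣ ⧸ H).out)⁻¹ * u ∈ H :=
    QuotientGroup.eq.1 (Quotient.out_eq _)
  set q := (QuotientGroup.mk u : (𝓞 F)ˣ ⧸ H).out with hq
  have hs' : u = q * s ^ 2 := by
    rw [powMonoidHom_apply] at hs
    rw [hs, mul_inv_cancel_left]
  refine ⟨s⁻¹, fun w => ?_⟩
  have : ((s⁻¹ : (𝓞 F)ˣ) : F) ^ 2 * algebraMap (𝓞 F) F y =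
      algebraMap (𝓞 F) F (q * gen I) := by
    have h1 : ((s⁻¹ : (𝓞 F)ˣ) : 𝓞 F) ^ 2 * y = q * gen I := by
      rw [← hu, hs']
      have : ((s⁻¹ : (𝓞 F)ˣ) : 𝓞 F) * s = 1 := by simp
      push_cast
      linear_combination (gen I * q * (((s⁻¹ : (𝓞 F)ˣ) : 𝓞 F) * s + 1)) * this
    rw [← h1, map_mul, map_pow]
  rw [this]
  exact hr ⟨(QuotientGroup.mk u, ⟨I, hI⟩, w), rfl⟩

end Packing

/-! ### The divisor bound for integers. -/

section DivisorBound

/-- The divisor bound `d(n) ≪ n ^ ε`. -/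
theorem exists_card_divisors_le {ε : ℝ} (hε : 0 < ε) :
    ∃ C : ℝ, 0 < C ∧ ∀ n : ℕ, n ≠ 0 → (n.divisors.card : ℝ) ≤ C * (n : ℝ) ^ ε := by
  -- Each prime `p < P` costs at most a factor `K` in `v + 1 ≤ K p^(vε)`. A prime `p ≥ P` satisfies
  -- `p^ε ≥ 2` and costs nothing, as `v + 1 ≤ 2^v`. The total loss is at most `K ^ P`.
  set K : ℝ := max 1 (1 / (ε * Real.log 2)) with hK
  set P : ℕ := ⌈(2 : ℝ) ^ (1 / ε)⌉₊ with hP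
  have hK1 : 1 ≤ K := le_max_left _ _
  have hl2 : 0 < Real.log 2 := Real.log_pos one_lt_two
  have hK2 : 1 ≤ K * (ε * Real.log 2) := by
    have := le_max_right 1 (1 / (ε * Real.log 2))
    rwa [div_le_iff₀ (by positivity)] at this
  have hsmall : ∀ p v : ℕ, 2 ≤ p → ((v : ℝ) + 1) ≤ K * ((p : ℝ) ^ v) ^ ε := by
    intro p v hp
    have h1 : Real.log 2 ≤ Real.log p := Real.log_le_log two_pos (by exact_mod_cast hp)
    have h2 : ((p : ℝ) ^ v) ^ ε = Real.exp (ε * (v * Real.log p)) := by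
      rw [Real.rpow_def_of_pos (by positivity), Real.log_pow, mul_comm]
    have h3 := Real.add_one_le_exp (ε * (v * Real.log p))
    rw [h2]
    have h4 : ε * (v * Real.log 2) ≤ ε * (v * Real.log p) := by gcongr
    have h5 : (v : ℝ) ≤ v * (K * (ε * Real.log 2)) := le_mul_of_one_le_right (by positivity) hK2
    have h6 : K * (ε * (v * Real.log 2) + 1) ≤ K * Real.exp (ε * (v * Real.log p)) := by
      gcongr
      linarith
    nlinarith
  have hlarge : ∀ p v : ℕ, P ≤ p → ((v : ℝ) + 1) ≤ ((p : ℝ) ^ v) ^ ε := by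
    intro p v hp
    have h1 : (2 : ℝ) ^ (1 / ε) ≤ p := (Nat.le_ceil _).trans (by exact_mod_cast hp)
    have h2 : (2 : ℝ) ≤ (p : ℝ) ^ ε := by
      calc (2 : ℝ) = ((2 : ℝ) ^ (1 / ε)) ^ ε := by
            rw [← Real.rpow_mul (by norm_num), one_div_mul_cancel hε.ne', Real.rpow_one]
        _ ≤ _ := Real.rpow_le_rpow (by positivity) h1 hε.le
    rw [← Real.rpow_pow_comm (Nat.cast_nonneg p)]
    calc (v : ℝ) + 1 ≤ 2 ^ v := by exact_mod_cast Nat.lt_two_pow_self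
      _ ≤ _ := by gcongr
  refine ⟨K ^ P, by positivity, fun n hn => ?_⟩
  have hn' : (n : ℝ) ^ ε = ∏ p ∈ n.primeFactors, ((p : ℝ) ^ n.factorization p) ^ ε := by
    rw [Real.finsetProd_rpow _ _ fun _ _ => by positivity]
    congr 1
    conv_lhs => rw [← Nat.prod_factorization_pow_eq_self hn]
    rw [Finsupp.prod, Nat.support_factorization]
    push_cast
    rfl
  have hstep : ∀ p ∈ n.primeFactors, ((n.factorization p + 1 : ℕ) : ℝ) ≤
      (if p < P then K else 1) * ((p : ℝ) ^ n.factorization p) ^ ε := by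
    intro p hp
    push_cast
    split_ifs with h
    · exact hsmall _ _ (Nat.prime_of_mem_primeFactors hp).two_le
    · rw [one_mul]
      exact hlarge _ _ (not_lt.1 h)
  rw [Nat.card_divisors hn, hn', Nat.cast_prod]
  refine (Finset.prod_le_prod (fun _ _ => Nat.cast_nonneg _) hstep).trans ?_
  rw [Finset.prod_mul_distrib]
  refine mul_le_mul_of_nonneg_right ?_ (Finset.prod_nonneg fun _ _ => by positivity)
  rw [Finset.prod_ite, Finset.prod_const_one, mul_one, Finset.prod_const]
  refine pow_le_pow_right₀ hK1 ?_
  calc _ ≤ (Finset.range P).card := Finset.card_le_card fun p hp =>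
        Finset.mem_range.2 (Finset.mem_filter.1 hp).2
    _ = P := Finset.card_range P

end DivisorBound

/-! ### The divisor bound for ideals, uniform in fields of bounded degree. -/

section IdealDivisors

variable {R : Type*} [CommRing R] [IsDedekindDomain R]

theorem finite_setOf_ideal_dvd {I : Ideal R} (hI : I ≠ 0) : {J : Ideal R | J ∣ I}.Finite :=
  @Set.toFinite _ _ (@Fintype.finite _ (UniqueFactorizationMonoid.fintypeSubtypeDvd I hI))

theorem ncard_ideal_dvd_mul_le {I J : Ideal R} (hI : I ≠ 0) (hJ : J ≠ 0) :
    {K : Ideal R | K ∣ I * J}.ncard ≤ {K : Ideal R | K ∣ I}.ncard * {K : Ideal R | K ∣ J}.ncard := by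
  rw [← Set.ncard_prod]
  have hfin : ({K : Ideal R | K ∣ I} ×ˢ {K : Ideal R | K ∣ J}).Finite :=
    (finite_setOf_ideal_dvd hI).prod (finite_setOf_ideal_dvd hJ)
  refine le_trans (Set.ncard_le_ncard ?_ (hfin.image fun p : Ideal R × Ideal R => p.1 * p.2))
    (Set.ncard_image_le hfin)
  intro K hK
  obtain ⟨K₁, K₂, h₁, h₂, rfl⟩ := exists_dvd_and_dvd_of_dvd_mul (show K ∣ I * J from hK)
  exact ⟨(K₁, K₂), ⟨h₁, h₂⟩, rfl⟩

theorem ncard_ideal_dvd_prime_pow_le {P : Ideal R} (hP : Prime P) (k : ℕ) :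
    {K : Ideal R | K ∣ P ^ k}.ncard ≤ k + 1 := by
  have h : {K : Ideal R | K ∣ P ^ k} ⊆ ((Finset.range (k + 1)).image fun i => P ^ i : Finset _) := by
    intro K hK
    obtain ⟨i, hi, hKi⟩ := (dvd_prime_pow hP k).1 hK
    simp only [Finset.coe_image, Set.mem_image, Finset.coe_range, Set.mem_Iio]
    exact ⟨i, by omega, (associated_iff_eq.1 hKi).symm⟩
  refine (Set.ncard_le_ncard h (Finset.finite_toSet _)).trans ?_
  rw [Set.ncard_coe_finset]
  exact Finset.card_image_le.trans (Finset.card_range _).le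

theorem ncard_ideal_dvd_multiset_prod_pow_le (s : Multiset (Ideal R)) (hs : ∀ P ∈ s, Prime P)
    (k : ℕ) : {K : Ideal R | K ∣ s.prod ^ k}.ncard ≤ (k + 1) ^ s.card := by
  induction s using Multiset.induction_on with
  | empty =>
    have : {K : Ideal R | K ∣ (0 : Multiset (Ideal R)).prod ^ k} ⊆ {1} := by
      intro K hK
      rw [Multiset.prod_zero, one_pow] at hK
      exact associated_iff_eq.1 (associated_one_iff_isUnit.2 (isUnit_of_dvd_one hK))
    simpa using Set.ncard_le_ncard this
  | cons P s ih =>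
    have hP := hs P (Multiset.mem_cons_self P s)
    have hs' : ∀ Q ∈ s, Prime Q := fun Q hQ => hs Q (Multiset.mem_cons_of_mem hQ)
    have h0 : s.prod ≠ 0 := Multiset.prod_ne_zero fun h => (hs' 0 h).ne_zero rfl
    rw [Multiset.prod_cons, mul_pow, Multiset.card_cons, pow_succ']
    exact (ncard_ideal_dvd_mul_le (pow_ne_zero _ hP.ne_zero) (pow_ne_zero _ h0)).trans
      (Nat.mul_le_mul (ncard_ideal_dvd_prime_pow_le hP k) (ih hs'))

variable (E : Type*) [Field E] [NumberField E]

/-- Each prime factor has norm divisible by `p`, and the norms multiply to `p ^ [E : ℚ]`. -/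
theorem card_normalizedFactors_span_prime_le {p : ℕ} (hp : p.Prime) :
    (UniqueFactorizationMonoid.normalizedFactors (Ideal.span {(p : 𝓞 E)})).card ≤
      Module.finrank ℚ E := by
  have hne : Ideal.span {(p : 𝓞 E)} ≠ 0 := by
    simpa using hp.ne_zero
  have hprod := Ideal.prod_normalizedFactors_eq_self hne
  have hnorm : Ideal.absNorm (Ideal.span {(p : 𝓞 E)}) = p ^ Module.finrank ℚ E := by
    rw [Ideal.absNorm_span_natCast, RingOfIntegers.rank]
  have hdvd : ∀ P ∈ UniqueFactorizationMonoid.normalizedFactors (Ideal.span {(p : 𝓞 E)}),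
      p ∣ Ideal.absNorm P := by
    intro P hP
    have hPp := UniqueFactorizationMonoid.prime_of_normalized_factor P hP
    have h1 : Ideal.absNorm P ∣ p ^ Module.finrank ℚ E := by
      rw [← hnorm]
      exact map_dvd _ (UniqueFactorizationMonoid.dvd_of_mem_normalizedFactors hP)
    obtain ⟨i, -, hi⟩ := (Nat.dvd_prime_pow hp).1 h1
    rcases Nat.eq_zero_or_pos i with rfl | hi0
    · rw [pow_zero, Ideal.absNorm_eq_one_iff] at hi
      exact absurd hPp.not_isUnit (by rw [hi]; simp)
    · rw [hi]
      exact dvd_pow_self p hi0.ne'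
  have key : ∀ s : Multiset (Ideal (𝓞 E)), (∀ P ∈ s, p ∣ Ideal.absNorm P) →
      p ^ s.card ∣ Ideal.absNorm s.prod := by
    intro s
    induction s using Multiset.induction_on with
    | empty => simp
    | cons P s ih =>
      intro h
      rw [Multiset.prod_cons, map_mul, Multiset.card_cons, pow_succ']
      exact mul_dvd_mul (h P (Multiset.mem_cons_self P s))
        (ih fun Q hQ => h Q (Multiset.mem_cons_of_mem hQ))
  have := key _ hdvd
  rw [hprod, hnorm] at this
  exact (Nat.pow_dvd_pow_iff_le_right hp.one_lt).1 this

theorem ncard_ideal_dvd_natCast_le {m : ℕ} (hm : m ≠ 0) :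
    {K : Ideal (𝓞 E) | K ∣ Ideal.span {(m : 𝓞 E)}}.ncard ≤
      m.divisors.card ^ Module.finrank ℚ E := by
  induction m using Nat.recOnPosPrimePosCoprime with
  | zero => exact absurd rfl hm
  | one =>
    have : {K : Ideal (𝓞 E) | K ∣ Ideal.span {((1 : ℕ) : 𝓞 E)}} ⊆ {1} := by
      intro K hK
      have h1 : Ideal.span {((1 : ℕ) : 𝓞 E)} = 1 := by simp
      rw [Set.mem_ofPred_eq, h1] at hK
      exact associated_iff_eq.1 (associated_one_iff_isUnit.2 (isUnit_of_dvd_one hK))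
    simpa using Set.ncard_le_ncard this
  | prime_pow p k hp hk =>
    have hne : Ideal.span {(p : 𝓞 E)} ≠ 0 := by
      simpa using hp.ne_zero
    have h := ncard_ideal_dvd_multiset_prod_pow_le
      (UniqueFactorizationMonoid.normalizedFactors (Ideal.span {(p : 𝓞 E)}))
      (fun P hP => UniqueFactorizationMonoid.prime_of_normalized_factor P hP) k
    rw [Ideal.prod_normalizedFactors_eq_self hne, Ideal.span_singleton_pow] at h
    rw [Nat.divisors_prime_pow hp, Finset.card_map, Finset.card_range, Nat.cast_pow]
    exact h.trans (Nat.pow_le_pow_right k.succ_pos (card_normalizedFactors_span_prime_le E hp))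
  | coprime a b ha hb hab iha ihb =>
    have hne : ∀ n : ℕ, 1 < n → Ideal.span {(n : 𝓞 E)} ≠ 0 := fun n hn => by
      simpa using (by omega : n ≠ 0)
    rw [hab.card_divisors_mul, mul_pow, Nat.cast_mul, ← Ideal.span_singleton_mul_span_singleton]
    exact (ncard_ideal_dvd_mul_le (hne a ha) (hne b hb)).trans
      (Nat.mul_le_mul (iha (by omega)) (ihb (by omega)))

end IdealDivisors

/-- The number of ideals dividing `m` in a number field of bounded degree is `O(m ^ ε)`, uniformly
in the field. -/
theorem exists_ncard_ideal_dvd_le.{w} (N : ℕ) {ε : ℝ} (hε : 0 < ε) : ∃ C : ℝ, 0 < C ∧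
    ∀ (E : Type w) [Field E] [NumberField E], Module.finrank ℚ E ≤ N → ∀ m : ℕ, m ≠ 0 →
      ({K : Ideal (𝓞 E) | K ∣ Ideal.span {(m : 𝓞 E)}}.ncard : ℝ) ≤ C * (m : ℝ) ^ ε := by
  -- The exponent `N + 1` in place of `N` keeps the quotient meaningful when `N = 0`.
  obtain ⟨C, hC, h⟩ := exists_card_divisors_le (ε := ε / (N + 1)) (by positivity)
  refine ⟨C ^ (N + 1), by positivity, fun E _ _ hE m hm => ?_⟩
  have h1 : 1 ≤ m.divisors.card :=
    Finset.card_pos.2 ⟨1, Nat.one_mem_divisors.2 hm⟩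
  calc ({K : Ideal (𝓞 E) | K ∣ Ideal.span {(m : 𝓞 E)}}.ncard : ℝ)
      ≤ (m.divisors.card : ℝ) ^ Module.finrank ℚ E := by
        exact_mod_cast ncard_ideal_dvd_natCast_le E hm
    _ ≤ (m.divisors.card : ℝ) ^ (N + 1) := by
        exact pow_le_pow_right₀ (by exact_mod_cast h1) (by omega)
    _ ≤ (C * (m : ℝ) ^ (ε / (N + 1))) ^ (N + 1) := by
        gcongr
        exact h m hm
    _ = C ^ (N + 1) * (m : ℝ) ^ ε := by
        rw [mul_pow, ← Real.rpow_natCast ((m : ℝ) ^ _), ← Real.rpow_mul (Nat.cast_nonneg m)]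
        congr 2
        push_cast
        field_simp

/-! ### Counting up to units of `𝓞 F`. -/

section UnitCover

universe u v

variable {F : Type u} [Field F] {A : Type v} [Ring A] [Algebra F A]

/-- Up to units of `𝓞 F`, the set `T` has at most `n` elements. -/
def UnitCover (F : Type u) [Field F] [Algebra F A] (T : Set A) (n : ℕ) : Prop :=
  ∃ T' : Set A, T'.Finite ∧ T'.ncard ≤ n ∧ ∀ x ∈ T, ∃ v : (𝓞 F)ˣ, v • x ∈ T'

theorem UnitCover.unitClasses {S T : Set A} {n : ℕ} (h : UnitCover F T n) (hS : S ⊆ T) :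
    (unitClasses (F := F) S).Finite ∧ (unitClasses (F := F) S).ncard ≤ n := by
  obtain ⟨T', hfin, hcard, hT⟩ := h
  have hsub : QuatCount.unitClasses (F := F) S ⊆
      (fun γ : A => (Quotient.mk'' γ : MulAction.orbitRel.Quotient (𝓞 F)ˣ A)) '' T' := by
    rintro _ ⟨x, hx, rfl⟩
    obtain ⟨v, hv⟩ := hT x (hS hx)
    exact ⟨_, hv, Quotient.sound' ⟨v, rfl⟩⟩
  have hf := hfin.image fun γ : A => (Quotient.mk'' γ : MulAction.orbitRel.Quotient (𝓞 F)ˣ A)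
  exact ⟨hf.subset hsub,
    (Set.ncard_le_ncard hsub hf).trans ((Set.ncard_image_le hfin).trans hcard)⟩

theorem UnitCover.mono {S T : Set A} {n : ℕ} (h : UnitCover F T n) (hS : S ⊆ T) :
    UnitCover F S n := by
  obtain ⟨T', hfin, hcard, hT⟩ := h
  exact ⟨T', hfin, hcard, fun x hx => hT x (hS hx)⟩

theorem unitCover_empty (n : ℕ) : UnitCover F (∅ : Set A) n :=
  ⟨∅, Set.finite_empty, by simp, by simp⟩

theorem UnitCover.union {S T : Set A} {m n : ℕ} (hS : UnitCover F S m) (hT : UnitCover F T n) :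
    UnitCover F (S ∪ T) (m + n) := by
  obtain ⟨S', hSf, hSc, hS⟩ := hS
  obtain ⟨T', hTf, hTc, hT⟩ := hT
  refine ⟨S' ∪ T', hSf.union hTf, (Set.ncard_union_le _ _).trans (by omega), ?_⟩
  rintro x (hx | hx)
  · obtain ⟨v, hv⟩ := hS x hx
    exact ⟨v, Or.inl hv⟩
  · obtain ⟨v, hv⟩ := hT x hx
    exact ⟨v, Or.inr hv⟩

theorem UnitCover.mul_left {T : Set A} {n : ℕ} (h : UnitCover F T n) (a : A) :
    UnitCover F ((a * ·) '' T) n := by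
  obtain ⟨T', hfin, hcard, hT⟩ := h
  refine ⟨(a * ·) '' T', hfin.image _, (Set.ncard_image_le hfin).trans hcard, ?_⟩
  rintro _ ⟨x, hx, rfl⟩
  obtain ⟨v, hv⟩ := hT x hx
  refine ⟨v, _, hv, ?_⟩
  exact mul_smul_comm (v : 𝓞 F) a x

theorem unitCover_of_fibers {ι : Type*} (s : Finset ι) (f : A → ι) {T : Set A} {n : ℕ}
    (hf : ∀ x ∈ T, f x ∈ s) (h : ∀ i ∈ s, UnitCover F {x ∈ T | f x = i} n) :
    UnitCover F T (s.card * n) := by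
  classical
  have key : ∀ t : Finset ι, t ⊆ s → UnitCover F {x ∈ T | f x ∈ t} (t.card * n) := by
    intro t
    induction t using Finset.induction_on with
    | empty =>
      intro _
      simpa using unitCover_empty (F := F) (A := A) 0
    | insert i t hi ih =>
      intro hts
      rw [Finset.card_insert_of_notMem hi, add_mul, one_mul]
      refine ((ih fun j hj => hts (Finset.mem_insert_of_mem hj)).union
        (h i (hts (Finset.mem_insert_self i t)))).mono ?_
      rintro x ⟨hx, hxi⟩
      rcases Finset.mem_insert.1 hxi with hxi | hxi
      · exact Or.inr ⟨hx, hxi⟩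
      · exact Or.inl ⟨hx, hxi⟩
  exact (key s subset_rfl).mono fun x hx => ⟨hx, hf x hx⟩

end UnitCover

/-! ### Elements of bounded norm and displacement. -/

section BoundedNorm

universe u v

theorem unit_smul_eq {F : Type u} [Field F] {A : Type v} [Ring A] [Algebra F A] (v : (𝓞 F)ˣ)
    (a : A) : v • a = (algebraMap (𝓞 F) F v) • a := rfl

/-- Elements of bounded norm and bounded displacement in an order are boundedly many up to units,
uniformly in the quaternion algebra. -/
theorem exists_unitCover_of_norm_le (F : Type u) [Field F] [NumberField F] [IsTotallyReal F]
    (M : ℕ) (b : ℝ) :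
    ∃ C : ℕ, ∀ (A : Type v) [DivisionRing A] [Algebra F A] (σ₀ : F →+* ℝ) (R : RealFrame F A σ₀)
      (O : Subalgebra (𝓞 F) A), (∀ x ∈ O, IsIntegral (𝓞 F) x) → ∀ T : Set A, T ⊆ O →
      (∀ x ∈ T, x ≠ 0) → (∀ x ∈ T, |Algebra.norm ℚ (nrd x : F)| ≤ M) →
      (∀ x ∈ T, MovesLess (R.split x) b) → UnitCover F T C := by
  obtain ⟨r, hr⟩ := exists_unit_sq_mul_le F M
  obtain ⟨C, hC⟩ := exists_packing_bound.{u, v} F r b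
  refine ⟨C, fun A _ _ σ₀ R O hO T hTO hT0 hTM hTb => ?_⟩
  -- All unit multiples of elements of `T` with reduced norm bounded at every place. Differences of
  -- distinct members are nonzero integral elements of a division algebra, so their norms are at
  -- least 1 and the packing bound applies.
  let T' : Set A := {y | ∃ x ∈ T, ∃ v : (𝓞 F)ˣ, v • x = y ∧
    ∀ w : InfinitePlace F, |realEmb w (nrd y)| ≤ r}
  have hT'O : ∀ y ∈ T', y ∈ O := by
    rintro _ ⟨x, hx, v, rfl, -⟩
    exact O.smul_mem (hTO hx) (v : 𝓞 F)
  have hpack := hC A σ₀ R T' ?_ ?_ ?_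
  · obtain ⟨hfin, hcard⟩ := hpack
    refine ⟨T', hfin, hcard, fun x hx => ?_⟩
    obtain ⟨n, hn⟩ := (R.exists_coe_eq_trd_nrd (hO x (hTO hx))).2
    have hn0 : n ≠ 0 := by
      rintro rfl
      exact R.nrd_ne_zero (hT0 x hx) (by rw [← hn, map_zero])
    obtain ⟨v, hv⟩ := hr n hn0 (by rw [hn]; exact hTM x hx)
    refine ⟨v, x, hx, v, rfl, fun w => ?_⟩
    rw [unit_smul_eq, R.nrd_smul, ← hn, abs_realEmb]
    exact hv w
  · intro x hx y hy hxy
    have hmem : x - y ∈ O := O.sub_mem (hT'O x hx) (hT'O y hy)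
    obtain ⟨n, hn⟩ := (R.exists_coe_eq_trd_nrd (hO _ hmem)).2
    have hn0 : n ≠ 0 := by
      rintro rfl
      exact R.nrd_ne_zero (sub_ne_zero.2 hxy) (by rw [← hn, map_zero])
    rw [← hn]
    exact one_le_abs_norm_coe hn0
  · rintro _ ⟨x, hx, v, -, h⟩
    exact h
  · rintro _ ⟨x, hx, v, rfl, -⟩
    rw [unit_smul_eq, R.split_smul]
    refine (hTb x hx).smul ?_
    rw [map_ne_zero]
    exact (v.isUnit.map (algebraMap (𝓞 F) F)).ne_zero

end BoundedNorm

/-! ### Commuting quotients: counting in a subfield. -/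

section CommutingCase

universe u v

variable {F : Type u} [Field F] {A : Type v} [DivisionRing A] [Algebra F A]

open scoped IsMulCommutative in
/-- A commuting set in a division algebra lies in a commutative subfield. -/
theorem exists_field_of_commute [FiniteDimensional F A] (S : Set A)
    (hS : ∀ a ∈ S, ∀ b ∈ S, a * b = b * a) :
    ∃ (E : Type v) (_ : Field E) (_ : Algebra F E) (_ : FiniteDimensional F E) (φ : E →ₐ[F] A),
      ∀ a ∈ S, ∃ y, φ y = a := by
  let B := Algebra.adjoin F S
  have : IsMulCommutative B := Algebra.isMulCommutative_adjoin F hS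
  have : IsDomain B := B.toSubring.instIsDomainSubtypeMem
  refine ⟨B, fieldOfFiniteDimensional F B, inferInstance, inferInstance, B.val, fun a ha => ?_⟩
  exact ⟨⟨a, Algebra.subset_adjoin ha⟩, rfl⟩

/-- An integer of `F` divides the absolute value of its norm. -/
theorem exists_dvd_natAbs_norm [NumberField F] (x : 𝓞 F) :
    ∃ k : 𝓞 F, x * k = ((Algebra.norm ℤ x).natAbs : 𝓞 F) := by
  have h := Ideal.absNorm_mem (Ideal.span {x})
  rw [Ideal.absNorm_span_singleton] at h
  obtain ⟨k, hk⟩ := Ideal.mem_span_singleton.1 h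
  exact ⟨k, hk.symm⟩

theorem natAbs_norm_eq [NumberField F] {x : 𝓞 F} {m : ℕ}
    (h : |Algebra.norm ℚ (algebraMap (𝓞 F) F x)| = m) : (Algebra.norm ℤ x).natAbs = m := by
  have h1 : ((|Algebra.norm ℤ x| : ℤ) : ℚ) = m := by
    rw [Int.cast_abs, Algebra.coe_norm_int]; exact h
  have h2 : |Algebra.norm ℤ x| = m := by exact_mod_cast h1
  rw [Int.abs_eq_natAbs] at h2
  exact_mod_cast h2

/-- Elements of an order whose quotients commute and whose displacement is bounded are few up to
units, uniformly in the quaternion algebra. -/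
theorem exists_unitCover_of_commute (F : Type u) [Field F] [NumberField F] [IsTotallyReal F]
    {ε : ℝ} (hε : 0 < ε) (b : ℝ) :
    ∃ C : ℝ, 0 < C ∧ ∀ (A : Type v) [DivisionRing A] [Algebra F A], Module.finrank F A = 4 →
      ∀ (σ₀ : F →+* ℝ) (R : RealFrame F A σ₀)
      (O : Subalgebra (𝓞 F) A), (∀ x ∈ O, IsIntegral (𝓞 F) x) → ∀ (m : ℕ), 1 ≤ m → ∀ T : Set A,
      T ⊆ O → (∀ x ∈ T, |Algebra.norm ℚ (nrd x : F)| = m) →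
      (∀ x ∈ T, MovesLess (R.split x) b) →
      (∀ x ∈ T, ∀ y ∈ T, ∀ z ∈ T, Commute (x⁻¹ * y) (x⁻¹ * z)) →
      ∃ n : ℕ, UnitCover F T n ∧ (n : ℝ) ≤ C * (m : ℝ) ^ ε := by
  obtain ⟨C₁, hC₁0, hC₁⟩ :=
    exists_ncard_ideal_dvd_le.{v} (Module.finrank ℚ F * 4) (half_pos hε)
  -- Used for quotients of elements of `T`: their norm is 1 and their displacement is below `2 * b`.
  obtain ⟨C₂, hC₂⟩ := exists_unitCover_of_norm_le.{u, v} F 1 (2 * b)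
  refine ⟨C₁ * (C₂ + 1), by positivity, fun A _ _ hA σ₀ R O hO m hm T hTO hTm hTb hTc => ?_⟩
  have : FiniteDimensional F A := Module.finite_of_finrank_pos (by omega)
  rcases T.eq_empty_or_nonempty with rfl | ⟨a, ha⟩
  · exact ⟨0, unitCover_empty 0, by push_cast; positivity⟩
  have hne : ∀ x ∈ T, x ≠ 0 := by
    rintro x hx rfl
    have := hTm 0 hx
    rw [R.nrd_zero, Algebra.norm_zero, abs_zero] at this
    have : m = 0 := by exact_mod_cast this.symm
    omega
  obtain ⟨E, _, _, _, φ, hφ⟩ := exists_field_of_commute (F := F) ((a⁻¹ * ·) '' T) (by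
    rintro _ ⟨x, hx, rfl⟩ _ ⟨y, hy, rfl⟩
    exact hTc a ha x hx y hy)
  have hφinj : Function.Injective φ := φ.toRingHom.injective
  have : CharZero E := charZero_of_injective_algebraMap (algebraMap F E).injective
  have : IsScalarTower ℚ F E := IsScalarTower.of_algebraMap_eq fun q => by simp
  have : FiniteDimensional ℚ E := FiniteDimensional.trans ℚ F E
  have : NumberField E := ⟨⟩
  have hdeg : Module.finrank ℚ E ≤ Module.finrank ℚ F * 4 := by
    rw [← Module.finrank_mul_finrank ℚ F E, ← hA]
    exact Nat.mul_le_mul_left _ (LinearMap.finrank_le_finrank_of_injective (f := φ.toLinearMap) hφinj)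
  let φ' : E →ₐ[𝓞 F] A := φ.restrictScalars (𝓞 F)
  -- The conjugate of `a`. Since `c * x = nrd(a) · a⁻¹x`, multiplication by `c` sends `T` into the
  -- image of `E` while staying in the order.
  set c : A := algebraMap F A (trd a) - a with hc
  have hca : c * a = algebraMap F A (nrd a) := by
    rw [← R.mul_trd_sub a, hc, sub_mul, mul_sub, Algebra.commutes]
  have hcO : c ∈ O := by
    obtain ⟨t, ht⟩ := (R.exists_coe_eq_trd_nrd (hO a (hTO ha))).1
    rw [hc, ← ht]
    exact O.sub_mem (O.algebraMap_mem t) (hTO ha)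
  have hnrda : (nrd a : F) ≠ 0 := R.nrd_ne_zero (hne a ha)
  have hc0 : c ≠ 0 := by
    intro h
    rw [h, zero_mul] at hca
    exact hnrda ((map_eq_zero _).1 hca.symm)
  have hnrdc : (nrd c : F) = nrd a := by
    have h1 := R.nrd_mul c a
    rw [hca, R.nrd_algebraMap, sq] at h1
    exact (mul_right_cancel₀ hnrda h1).symm
  have hY : ∀ x ∈ T, ∃ y : 𝓞 E, φ (algebraMap (𝓞 E) E y) = c * x := by
    intro x hx
    obtain ⟨y, hy⟩ := hφ _ ⟨x, hx, rfl⟩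
    have h1 : φ (algebraMap F E (nrd a) * y) = c * x := by
      rw [map_mul, AlgHom.commutes, hy, ← hca]
      simp only [mul_assoc]
      rw [mul_inv_cancel_left₀ (hne a ha)]
    have h2 : IsIntegral (𝓞 F) (algebraMap F E (nrd a) * y) := by
      refine (isIntegral_algHom_iff φ' hφinj).1 ?_
      change IsIntegral (𝓞 F) (φ (algebraMap F E (nrd a) * y))
      rw [h1]
      exact hO _ (O.mul_mem hcO (hTO hx))
    have h3 : IsIntegral ℤ (algebraMap F E (nrd a) * y) := isIntegral_trans (A := 𝓞 F) _ h2
    exact ⟨⟨_, h3⟩, h1⟩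
  choose! Y hYφ using hY
  -- An element divides its reduced norm `n`, with cofactor its conjugate, and `n` divides its own
  -- norm to `ℤ`, which is `m²` up to sign.
  have hYdvd : ∀ x ∈ T, Ideal.span {Y x} ∣ Ideal.span {((m ^ 2 : ℕ) : 𝓞 E)} := by
    intro x hx
    have hcx := O.mul_mem hcO (hTO hx)
    obtain ⟨⟨t, ht⟩, n, hn⟩ := R.exists_coe_eq_trd_nrd (hO _ hcx)
    have hnorm : (Algebra.norm ℤ n).natAbs = m ^ 2 := by
      refine natAbs_norm_eq ?_
      rw [hn, R.nrd_mul, map_mul, abs_mul, hnrdc, hTm a ha, hTm x hx]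
      push_cast
      ring
    obtain ⟨k, hk⟩ := exists_dvd_natAbs_norm n
    rw [hnorm] at hk
    rw [Ideal.dvd_span_singleton, Ideal.mem_span_singleton]
    refine ⟨(algebraMap (𝓞 F) (𝓞 E) t - Y x) * algebraMap (𝓞 F) (𝓞 E) k, ?_⟩
    apply RingOfIntegers.coe_injective
    apply hφinj
    have hcoe : ∀ s : 𝓞 F, φ (algebraMap (𝓞 E) E (algebraMap (𝓞 F) (𝓞 E) s)) =
        algebraMap F A (algebraMap (𝓞 F) F s) := fun s => by
      rw [← φ.commutes]
      rfl
    simp only [map_mul, map_sub, hcoe, hYφ x hx, ht]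
    rw [← mul_assoc, R.mul_trd_sub, ← hn, ← map_mul, ← map_mul, hk, map_natCast, map_natCast,
      map_natCast, map_natCast]
  have hm0 : m ^ 2 ≠ 0 := pow_ne_zero _ (by omega)
  have hfin : {K : Ideal (𝓞 E) | K ∣ Ideal.span {((m ^ 2 : ℕ) : 𝓞 E)}}.Finite := by
    refine finite_setOf_ideal_dvd ?_
    simpa using (by omega : m ≠ 0)
  refine ⟨hfin.toFinset.card * C₂, ?_, ?_⟩
  · refine unitCover_of_fibers hfin.toFinset (fun x => Ideal.span {Y x}) ?_ ?_
    · intro x hx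
      exact hfin.mem_toFinset.2 (hYdvd x hx)
    · intro K _
      rcases Set.eq_empty_or_nonempty {x ∈ T | Ideal.span {Y x} = K} with h | ⟨x₀, hx₀, hx₀K⟩
      · rw [h]
        exact unitCover_empty _
      · let B : Subalgebra (𝓞 F) A := (integralClosure (𝓞 F) E).map φ'
        have hB : ∀ x ∈ B, IsIntegral (𝓞 F) x := by
          rintro _ ⟨y, hy, rfl⟩
          exact IsIntegral.map φ' hy
        -- Elements with the same ideal differ by a unit of `𝓞 E`. Their quotients lie in `B`, the
        -- image of the integers of `E`. It need not span `A`, which is why the bounded-norm count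
        -- asks only for integral elements.
        have hmain := hC₂ A σ₀ R B hB ((x₀⁻¹ * ·) '' {x ∈ T | Ideal.span {Y x} = K}) ?_ ?_ ?_ ?_
        · refine (hmain.mul_left x₀).mono ?_
          intro x hx
          exact ⟨x₀⁻¹ * x, ⟨x, hx, rfl⟩, mul_inv_cancel_left₀ (hne x₀ hx₀) x⟩
        · rintro _ ⟨x, ⟨hx, hxK⟩, rfl⟩
          obtain ⟨u, hu⟩ := Ideal.span_singleton_eq_span_singleton.1 (hx₀K.trans hxK.symm)
          refine ⟨algebraMap (𝓞 E) E u, (RingOfIntegers.isIntegral_coe (u : 𝓞 E)).tower_top, ?_⟩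
          change φ (algebraMap (𝓞 E) E u) = x₀⁻¹ * x
          have h1 : c * x₀ * φ (algebraMap (𝓞 E) E u) = c * x := by
            rw [← hYφ x hx, ← hYφ x₀ hx₀, ← hu, map_mul, map_mul]
          rw [mul_assoc] at h1
          rw [eq_inv_mul_iff_mul_eq₀ (hne x₀ hx₀)]
          exact mul_left_cancel₀ hc0 h1
        · rintro _ ⟨x, ⟨hx, -⟩, rfl⟩
          exact mul_ne_zero (inv_ne_zero (hne x₀ hx₀)) (hne x hx)
        · rintro _ ⟨x, ⟨hx, -⟩, rfl⟩
          have : (m : ℚ) ≠ 0 := by exact_mod_cast (by omega : m ≠ 0)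
          have h1 := R.nrd_mul x₀ (x₀⁻¹ * x)
          rw [mul_inv_cancel_left₀ (hne x₀ hx₀)] at h1
          have h2 := hTm x hx
          rw [h1, map_mul, abs_mul, hTm x₀ hx₀] at h2
          rw [Nat.cast_one]
          exact (mul_left_cancel₀ this (h2.trans (mul_one _).symm)).le
        · rintro _ ⟨x, ⟨hx, -⟩, rfl⟩
          refine (hTb x₀ hx₀).of_mul_eq (hTb x hx) ?_
          rw [← map_mul, mul_inv_cancel_left₀ (hne x₀ hx₀)]
  · have h := hC₁ E hdeg (m ^ 2) hm0
    rw [Set.ncard_eq_toFinset_card _ hfin] at h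
    have h2 : (((m ^ 2 : ℕ) : ℝ)) ^ (ε / 2) = (m : ℝ) ^ ε := by
      push_cast
      rw [← Real.rpow_natCast, ← Real.rpow_mul (Nat.cast_nonneg m)]
      congr 1
      push_cast
      ring
    rw [h2] at h
    rw [Nat.cast_mul]
    have h3 : (0 : ℝ) ≤ C₁ * (m : ℝ) ^ ε := by positivity
    calc (hfin.toFinset.card : ℝ) * C₂ ≤ (C₁ * (m : ℝ) ^ ε) * C₂ := by gcongr
      _ ≤ C₁ * (C₂ + 1) * (m : ℝ) ^ ε := by nlinarith

end CommutingCase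

/-! ### Noncommuting quotients: bounding the discriminant. -/

section Discriminant

universe u v

theorem normSq_commutator_le (p q : Quaternion ℝ) :
    Quaternion.normSq (p * q - q * p) ≤ 4 * (Quaternion.normSq p * Quaternion.normSq q) := by
  simp only [Quaternion.normSq_eq_norm_mul_self]
  have h : ‖p * q - q * p‖ ≤ 2 * (‖p‖ * ‖q‖) := by
    refine (norm_sub_le _ _).trans ?_
    rw [norm_mul, norm_mul]
    linarith [mul_comm ‖p‖ ‖q‖]
  calc ‖p * q - q * p‖ * ‖p * q - q * p‖ ≤ (2 * (‖p‖ * ‖q‖)) * (2 * (‖p‖ * ‖q‖)) := by gcongr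
    _ = _ := by ring

variable {F : Type u} [Field F] {A : Type v} [DivisionRing A] [Algebra F A] {σ₀ : F →+* ℝ}

theorem RealFrame.det_trd_mul (R : RealFrame F A σ₀) (g a b : A) (k : F) (x : Fin 4 → A)
    (hx : x = ![g, g * a, g * b, k • (g * (a * b))]) :
    (Matrix.of fun i j => (trd (x i * x j) : F)).det =
      -(k * nrd g ^ 2 * nrd (a * b - b * a)) ^ 2 := by
  apply σ₀.injective
  have h : (fun i => R.split (x i)) = ![R.split g, R.split g * R.split a, R.split g * R.split b,
      σ₀ k • (R.split g * (R.split a * R.split b))] := by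
    ext i : 1
    fin_cases i <;> simp [hx, R.split_smul]
  have hdet := det_trace_commutator (R.split g) (R.split a) (R.split b) (σ₀ k) _ h
  rw [RingHom.map_det, map_neg, map_pow, map_mul, map_mul, map_pow, ← R.split_det, ← R.split_det,
    map_sub, map_mul, map_mul, ← hdet]
  congr 1
  ext i j
  simp [← R.split_trace]

variable [NumberField F]

/-- Any Gram determinant of elements of an order bounds the discriminant. -/
theorem RealFrame.discNorm_le (R : RealFrame F A σ₀) {O : Subalgebra (𝓞 F) A}
    (hO : ∀ x ∈ O, IsIntegral (𝓞 F) x) (x : Fin 4 → A) (hx : ∀ i, x i ∈ O)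
    (h0 : (Matrix.of fun i j => (trd (x i * x j) : F)).det ≠ 0) :
    1 ≤ discNorm O ∧
      (discNorm O : ℚ) ≤ |Algebra.norm ℚ (Matrix.of fun i j => (trd (x i * x j) : F)).det| := by
  choose t ht using fun i j => (R.exists_coe_eq_trd_nrd (hO _ (O.mul_mem (hx i) (hx j)))).1
  set d : 𝓞 F := (Matrix.of t).det with hd
  have hdF : algebraMap (𝓞 F) F d = (Matrix.of fun i j => (trd (x i * x j) : F)).det := by
    rw [hd, RingHom.map_det]
    congr 1
    ext i j
    exact ht i j
  have hd0 : d ≠ 0 := by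
    rintro h
    rw [h, map_zero] at hdF
    exact h0 hdF.symm
  have hmem : d ∈ disc O := Ideal.subset_span ⟨x, hx, hdF⟩
  have hN0 : Algebra.norm ℤ d ≠ 0 := Algebra.norm_ne_zero_iff.2 hd0
  have hdvd := Int.natAbs_dvd_natAbs.2 (Ideal.absNorm_dvd_norm_of_mem hmem)
  rw [Int.natAbs_natCast] at hdvd
  have hpos : 0 < (Algebra.norm ℤ d).natAbs := Int.natAbs_pos.2 hN0
  refine ⟨Nat.pos_of_dvd_of_pos hdvd hpos, ?_⟩
  rw [← hdF, ← Algebra.coe_norm_int, ← Int.cast_abs, Int.abs_eq_natAbs, Int.cast_natCast]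
  exact_mod_cast Nat.le_of_dvd hpos hdvd

/-- The split place contributes `κ`; each other real place contributes at most 4, by
multiplicativity of the quaternion norm. -/
theorem RealFrame.abs_norm_nrd_commutator_le [IsTotallyReal F] (R : RealFrame F A σ₀) {a b : A}
    {κ : ℝ} (hκ : 0 ≤ κ)
    (h : |(R.split a * R.split b - R.split b * R.split a).det| ≤
      κ * ((R.split a).det * (R.split b).det)) :
    ((|Algebra.norm ℚ (nrd (a * b - b * a) : F)| : ℚ) : ℝ) ≤
      κ * 4 ^ (Fintype.card (InfinitePlace F) - 1) *
        ((|Algebra.norm ℚ (nrd a * nrd b : F)| : ℚ) : ℝ) := by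
  refine abs_norm_le_of_forall (σ₀ := σ₀) hκ ?_ fun σ hσ => ?_
  · rw [← map_mul, ← map_mul, ← map_sub, R.split_det, R.split_det, R.split_det, ← map_mul] at h
    exact h.trans (mul_le_mul_of_nonneg_left (le_abs_self _) hκ)
  · rw [map_mul, ← R.normSq_quat σ hσ, ← R.normSq_quat σ hσ, ← R.normSq_quat σ hσ, map_sub,
      map_mul, map_mul, abs_of_nonneg Quaternion.normSq_nonneg, abs_of_nonneg
      (mul_nonneg Quaternion.normSq_nonneg Quaternion.normSq_nonneg)]
    exact normSq_commutator_le _ _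

/-- If quotients of elements of norm `m` and displacement less than `δ` do not commute, then the
discriminant is bounded. -/
theorem exists_discNorm_le_of_not_commute (F : Type u) [Field F] [NumberField F] [IsTotallyReal F]
    (b : ℝ) :
    ∃ K : ℝ, 0 < K ∧ ∀ (A : Type v) [DivisionRing A] [Algebra F A] (σ₀ : F →+* ℝ)
      (R : RealFrame F A σ₀) (O : Subalgebra (𝓞 F) A), (∀ x ∈ O, IsIntegral (𝓞 F) x) →
      ∀ (m : ℕ), 1 ≤ m → ∀ (δ : ℝ), 0 < δ → δ ≤ b → ∀ x : Fin 3 → A, (∀ i, x i ∈ O) →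
      (∀ i, |Algebra.norm ℚ (nrd (x i) : F)| = m) → (∀ i, MovesLess (R.split (x i)) δ) →
      (∀ i, 0 < σ₀ (nrd (x 0)) * σ₀ (nrd (x i))) →
      ¬ Commute ((x 0)⁻¹ * x 1) ((x 0)⁻¹ * x 2) →
      1 ≤ discNorm O ∧ (discNorm O : ℝ) ≤ K * δ ^ 4 * (m : ℝ) ^ 6 := by
  obtain ⟨K, hK0, hK⟩ := exists_abs_det_commutator_le (2 * b)
  refine ⟨(4 * K * 4 ^ (Fintype.card (InfinitePlace F) - 1)) ^ 2, by positivity, ?_⟩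
  intro A _ _ σ₀ R O hO m hm δ hδ hδb x hxO hxm hxδ hpos hcomm
  have hmQ : (m : ℚ) ≠ 0 := by exact_mod_cast (by omega : m ≠ 0)
  have hx0 : ∀ i, x i ≠ 0 := by
    intro i h
    have := hxm i
    rw [h, R.nrd_zero, Algebra.norm_zero, abs_zero] at this
    exact hmQ this.symm
  set a := (x 0)⁻¹ * x 1 with ha
  set c := (x 0)⁻¹ * x 2 with hc
  have ha' : x 0 * a = x 1 := mul_inv_cancel_left₀ (hx0 0) _
  have hc' : x 0 * c = x 2 := mul_inv_cancel_left₀ (hx0 0) _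
  have hcne : a * c - c * a ≠ 0 := fun h => hcomm (sub_eq_zero.1 h)
  have hnorm1 : ∀ u i, x 0 * u = x i → |Algebra.norm ℚ (nrd u : F)| = 1 := by
    intro u i hu
    have h2 := hxm i
    rw [← hu, R.nrd_mul, map_mul, abs_mul, hxm 0] at h2
    exact mul_left_cancel₀ hmQ (h2.trans (mul_one _).symm)
  -- Equal signs at the split place make the quotients orientation preserving, as the
  -- near-commutation estimate requires.
  have hdetpos : ∀ u i, x 0 * u = x i → 0 < (R.split u).det := by
    intro u i hu
    have h2 := hpos i
    rw [← hu, R.nrd_mul, map_mul, ← mul_assoc] at h2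
    rw [R.split_det]
    exact pos_of_mul_pos_right h2 (mul_self_nonneg _)
  have hmoves : ∀ u i, x 0 * u = x i → MovesLess (R.split u) (2 * δ) := by
    intro u i hu
    refine (hxδ 0).of_mul_eq (hxδ i) ?_
    rw [← map_mul, hu]
  have hbound : ((|Algebra.norm ℚ (nrd (a * c - c * a) : F)| : ℚ) : ℝ) ≤
      K * (2 * δ) ^ 2 * 4 ^ (Fintype.card (InfinitePlace F) - 1) := by
    have h := R.abs_norm_nrd_commutator_le (a := a) (b := c) (κ := K * (2 * δ) ^ 2) (by positivity)
      (hK (2 * δ) (R.split a) (R.split c) (by positivity) (by linarith)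
        (hmoves a 1 ha') (hmoves c 2 hc') (hdetpos a 1 ha') (hdetpos c 2 hc'))
    rwa [map_mul, abs_mul, hnorm1 a 1 ha', hnorm1 c 2 hc', mul_one, Rat.cast_one, mul_one] at h
  -- The product `x₀ac` need not lie in the order. Scaled by `nrd(x₀)` it becomes `x₁x̄₀x₂`, which
  -- does.
  let y : Fin 4 → A := ![x 0, x 0 * a, x 0 * c, (nrd (x 0) : F) • (x 0 * (a * c))]
  have hy3 : (nrd (x 0) : F) • (x 0 * (a * c)) =
      x 1 * ((algebraMap F A (trd (x 0)) - x 0) * x 2) := by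
    have h1 : (algebraMap F A (trd (x 0)) - x 0) * x 0 = algebraMap F A (nrd (x 0)) := by
      rw [← R.mul_trd_sub (x 0), sub_mul, mul_sub, Algebra.commutes]
    rw [← hc', ← mul_assoc _ (x 0) c, h1, ← Algebra.smul_def, mul_smul_comm, ← mul_assoc, ha']
  have hyO : ∀ i, y i ∈ O := by
    intro i
    obtain ⟨t, ht⟩ := (R.exists_coe_eq_trd_nrd (hO _ (hxO 0))).1
    have h3 : x 1 * ((algebraMap F A (trd (x 0)) - x 0) * x 2) ∈ O := by
      rw [← ht]
      exact O.mul_mem (hxO 1) (O.mul_mem (O.sub_mem (O.algebraMap_mem t) (hxO 0)) (hxO 2))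
    fin_cases i
    · exact hxO 0
    · change x 0 * a ∈ O
      rw [ha']; exact hxO 1
    · change x 0 * c ∈ O
      rw [hc']; exact hxO 2
    · change (nrd (x 0) : F) • (x 0 * (a * c)) ∈ O
      rw [hy3]; exact h3
  have hdet := R.det_trd_mul (x 0) a c (nrd (x 0)) y rfl
  have hn0 := R.nrd_ne_zero (hx0 0)
  obtain ⟨h1, h2⟩ := R.discNorm_le hO y hyO (by
    rw [hdet, neg_ne_zero]
    exact pow_ne_zero _ (mul_ne_zero (mul_ne_zero hn0 (pow_ne_zero _ hn0)) (R.nrd_ne_zero hcne)))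
  refine ⟨h1, ?_⟩
  -- The scaling gives one factor `nrd(x₀)` and the common left factor two more; squaring yields
  -- `m⁶`.
  have h3 : |Algebra.norm ℚ (Matrix.of fun i j => (trd (y i * y j) : F)).det| =
      (m : ℚ) ^ 6 * |Algebra.norm ℚ (nrd (a * c - c * a) : F)| ^ 2 := by
    have hneg : |Algebra.norm ℚ (-1 : F)| = 1 := by
      have := congrArg abs (map_mul (Algebra.norm ℚ) (-1 : F) (-1))
      rw [neg_one_mul, neg_neg, map_one, abs_one, abs_mul] at this
      nlinarith [abs_nonneg (Algebra.norm ℚ (-1 : F))]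
    rw [hdet, neg_eq_neg_one_mul, map_mul, abs_mul, hneg, one_mul, map_pow, map_mul, map_mul,
      map_pow, abs_pow, abs_mul, abs_mul, abs_pow, hxm 0]
    ring
  rw [h3] at h2
  have h4 : (discNorm O : ℝ) ≤
      (m : ℝ) ^ 6 * ((|Algebra.norm ℚ (nrd (a * c - c * a) : F)| : ℚ) : ℝ) ^ 2 := by
    exact_mod_cast h2
  refine h4.trans ?_
  have h5 : (0 : ℝ) ≤ ((|Algebra.norm ℚ (nrd (a * c - c * a) : F)| : ℚ) : ℝ) := by
    exact_mod_cast abs_nonneg _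
  calc _ ≤ (m : ℝ) ^ 6 * (K * (2 * δ) ^ 2 * 4 ^ (Fintype.card (InfinitePlace F) - 1)) ^ 2 := by
        gcongr
    _ = _ := by ring

end Discriminant

/-- The numerical contradiction between a large discriminant and a small displacement. -/
theorem rpow_le_of_le_mul {K c b ε δ D m : ℝ} (hK : 0 < K) (hc : 0 < c) (hε : 0 < ε)
    (hδ : 0 < δ) (hδb : δ ≤ b) (hD : 1 ≤ D) (hm : 1 ≤ m) (h1 : D ≤ K * δ ^ 4 * m ^ 6)
    (h2 : δ ≤ c * D ^ (1 - ε) * m ^ (-6 - ε)) : m ^ ε ≤ K * c * b ^ 3 := by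
  have hb0 : 0 < b := hδ.trans_le hδb
  have hm0 : 0 < m := by linarith
  have hD0 : 0 < D := by linarith
  -- Only `D ≥ 1` is needed here, so `ε > 1` is allowed.
  have h3 : D ^ (1 - ε) ≤ D := by
    calc D ^ (1 - ε) ≤ D ^ (1 : ℝ) := Real.rpow_le_rpow_of_exponent_le hD (by linarith)
      _ = D := Real.rpow_one D
  have h4 : m ^ (-6 - ε) * (m ^ 6 * m ^ ε) = 1 := by
    rw [← Real.rpow_natCast m 6, ← Real.rpow_add hm0, ← Real.rpow_add hm0]
    norm_num
  have hε0 : 0 < m ^ ε := Real.rpow_pos_of_pos hm0 ε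
  have h5 : δ * (m ^ 6 * m ^ ε) ≤ c * D := by
    calc δ * (m ^ 6 * m ^ ε) ≤ (c * D ^ (1 - ε) * m ^ (-6 - ε)) * (m ^ 6 * m ^ ε) := by gcongr
      _ = c * D ^ (1 - ε) * (m ^ (-6 - ε) * (m ^ 6 * m ^ ε)) := by ring
      _ ≤ c * D := by rw [h4, mul_one]; gcongr
  -- One factor `δ` is traded for `c D m^(-6-ε)`, the other three are bounded by `b`, and `D`
  -- cancels.
  have h6 : D * m ^ ε ≤ D * (K * c * b ^ 3) := by
    calc D * m ^ ε ≤ (K * δ ^ 4 * m ^ 6) * m ^ ε := by gcongr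
      _ = K * δ ^ 3 * (δ * (m ^ 6 * m ^ ε)) := by ring
      _ ≤ K * b ^ 3 * (c * D) := by gcongr
      _ = _ := by ring
  exact le_of_mul_le_mul_left h6 hD0

end QuatCount

/-! ### The dichotomy. -/

theorem mainTheorem8 (F : Type*) [Field F] [NumberField F] [IsTotallyReal F]
    (ε : ℝ) (hε : 0 < ε) (c : ℝ) (hc : 0 < c) (B : ℝ) (hB : 0 < B) :
    ∃ C : ℝ, 0 < C ∧
      ∀ (A : Type*) [DivisionRing A] [Algebra F A] [Algebra.IsCentral F A],
        Module.finrank F A = 4 →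
      ∀ (σ₀ : F →+* ℝ)
        (e : (QuatCount.RealAt σ₀ ⊗[F] A) ≃ₐ[ℝ] Matrix (Fin 2) (Fin 2) ℝ),
        (∀ σ : F →+* ℝ, σ ≠ σ₀ →
          Nonempty ((QuatCount.RealAt σ ⊗[F] A) ≃ₐ[ℝ] Quaternion ℝ)) →
      ∀ O : Subalgebra (𝓞 F) A, QuatCount.IsOrder O →
      ∀ (m : ℕ), 1 ≤ m →
      ∀ (z : UpperHalfPlane) (δ : ℝ), 0 < δ → δ ≤ B →
        δ ≤ c * (QuatCount.discNorm O : ℝ) ^ (1 - ε) * (m : ℝ) ^ (-6 - ε) →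
        (QuatCount.unitClasses (F := F) (QuatCount.countSet e O m z δ)).Finite ∧
        ((QuatCount.unitClasses (F := F) (QuatCount.countSet e O m z δ)).ncard : ℝ)
          ≤ C * (m : ℝ) ^ ε := by
  obtain ⟨K, hK0, hK⟩ := QuatCount.exists_discNorm_le_of_not_commute F B
  -- The noncommuting case forces `m ^ ε ≤ K c B³`, hence this bound on the norm.
  obtain ⟨C₁, hC₁⟩ :=
    QuatCount.exists_unitCover_of_norm_le F ⌊(K * c * B ^ 3) ^ (1 / ε)⌋₊ B
  obtain ⟨C₂, hC₂0, hC₂⟩ := QuatCount.exists_unitCover_of_commute F hε B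
  refine ⟨C₁ + 2 * C₂, by positivity, ?_⟩
  intro A _ _ _ hA σ₀ e he O hO m hm z δ hδ hδB hδD
  have : FiniteDimensional F A := Module.finite_of_finrank_pos (by omega)
  obtain ⟨R, hR⟩ := QuatCount.exists_realFrame e he z
  have hOint : ∀ x ∈ O, IsIntegral (𝓞 F) x := IsIntegral.of_mem_of_fg O hO.1
  have hm1 : (1 : ℝ) ≤ m := by exact_mod_cast hm
  have hmε : (1 : ℝ) ≤ (m : ℝ) ^ ε := Real.one_le_rpow hm1 hε.le
  set S := QuatCount.countSet e O m z δ with hS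
  have hSδ : ∀ x ∈ S, QuatCount.MovesLess (R.split x) δ := fun x hx => hR x δ hx.2.2
  have hSm : ∀ x ∈ S, |Algebra.norm ℚ (QuatCount.nrd x : F)| = m := fun x hx => hx.2.1
  suffices h : ∃ n : ℕ, QuatCount.UnitCover F S n ∧ (n : ℝ) ≤ (C₁ + 2 * C₂) * (m : ℝ) ^ ε by
    obtain ⟨n, hn, hnle⟩ := h
    obtain ⟨h1, h2⟩ := hn.unitClasses subset_rfl
    exact ⟨h1, le_trans (by exact_mod_cast h2) hnle⟩
  by_cases hcomm : ∃ x : Fin 3 → A, (∀ i, x i ∈ S) ∧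
      (∀ i, 0 < σ₀ (QuatCount.nrd (x 0)) * σ₀ (QuatCount.nrd (x i))) ∧
      ¬ Commute ((x 0)⁻¹ * x 1) ((x 0)⁻¹ * x 2)
  · obtain ⟨x, hxS, hpos, hx⟩ := hcomm
    obtain ⟨hD1, hD2⟩ := hK A σ₀ R O hOint m hm δ hδ hδB x (fun i => (hxS i).1)
      (fun i => hSm _ (hxS i)) (fun i => hSδ _ (hxS i)) hpos hx
    have h1 := QuatCount.rpow_le_of_le_mul hK0 hc hε hδ hδB (by exact_mod_cast hD1) hm1 hD2 hδD
    have h2 : (m : ℝ) ≤ (K * c * B ^ 3) ^ (1 / ε) := by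
      calc (m : ℝ) = ((m : ℝ) ^ ε) ^ (1 / ε) := by
            rw [← Real.rpow_mul (by positivity), mul_one_div_cancel hε.ne', Real.rpow_one]
        _ ≤ _ := Real.rpow_le_rpow (by positivity) h1 (by positivity)
    have h3 : m ≤ ⌊(K * c * B ^ 3) ^ (1 / ε)⌋₊ := Nat.le_floor h2
    refine ⟨C₁, hC₁ A σ₀ R O hOint S (fun x hx => hx.1) ?_ ?_ ?_, ?_⟩
    · rintro x hx rfl
      have h4 := hSm 0 hx
      rw [R.nrd_zero, Algebra.norm_zero, abs_zero] at h4
      have : m = 0 := by exact_mod_cast h4.symm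
      omega
    · intro x hx
      rw [hSm x hx]
      exact_mod_cast h3
    · exact fun x hx => (hSδ x hx).mono hδB
    · have : (0 : ℝ) ≤ C₁ := Nat.cast_nonneg _
      nlinarith
  · push Not at hcomm
    -- Commutation is known only within one sign of the reduced norm at `σ₀`; the two signs are
    -- counted separately, whence `2 * C₂`.
    have hsign : ∀ T : Set A, T ⊆ S →
        (∀ x ∈ T, ∀ y ∈ T, 0 < σ₀ (QuatCount.nrd x) * σ₀ (QuatCount.nrd y)) →
        ∃ n : ℕ, QuatCount.UnitCover F T n ∧ (n : ℝ) ≤ C₂ * (m : ℝ) ^ ε := by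
      intro T hTS hT
      refine hC₂ A hA σ₀ R O hOint m hm T (fun x hx => (hTS hx).1) (fun x hx => hSm x (hTS hx))
        (fun x hx => (hSδ x (hTS hx)).mono hδB) ?_
      intro x hx y hy w hw
      refine hcomm ![x, y, w] ?_ ?_
      · intro i
        fin_cases i
        exacts [hTS hx, hTS hy, hTS hw]
      · intro i
        fin_cases i
        exacts [hT x hx x hx, hT x hx y hy, hT x hx w hw]
    obtain ⟨n₁, hn₁, hn₁'⟩ := hsign {x ∈ S | 0 < σ₀ (QuatCount.nrd x)} (fun x hx => hx.1)
      fun x hx y hy => mul_pos hx.2 hy.2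
    obtain ⟨n₂, hn₂, hn₂'⟩ := hsign {x ∈ S | σ₀ (QuatCount.nrd x) < 0} (fun x hx => hx.1)
      fun x hx y hy => mul_pos_of_neg_of_neg hx.2 hy.2
    refine ⟨n₁ + n₂, (hn₁.union hn₂).mono ?_, ?_⟩
    · intro x hx
      have hne : σ₀ (QuatCount.nrd x) ≠ 0 := by
        intro h
        have h4 := hSm x hx
        rw [(map_eq_zero σ₀).1 h, Algebra.norm_zero, abs_zero] at h4
        have : m = 0 := by exact_mod_cast h4.symm
        omega
      rcases hne.lt_or_gt with h | h
      · exact Or.inr ⟨hx, h⟩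
      · exact Or.inl ⟨hx, h⟩
    · push_cast
      have : (0 : ℝ) ≤ C₁ * (m : ℝ) ^ ε := by positivity
      linarith
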